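/- Let $k$ be a field, $S=k[x_1,\dots,x_n]$, and let $I=J_1\cap J_2\cap J_3$, where $J_i=(x_1^{a_{i1}},\dots,x_n^{a_{in}})$ with all $a_{ij}\ge 1$. Assume that $R=S/I$ has type three, i.e. the socle $0:_R\mathfrak m$ of the local Artinian ring $R$ with maximal ideal $\mathfrak m$ has dimension $3$ over the residue field $R/\mathfrak m$. Then $R$ has a canonical module (an injective hull of its residue field), and for every canonical module $\omega$ of $R$ the following conditions are equivalent: (1) $\mathfrak m\subseteq\omega^*(\omega)$, where $\omega^*(\omega)$ is the ideal generated by all $f(x)$ with $x\in\omega$ and $f\in\operatorname{Hom}_R(\omega,R)$; (2) $K:(K:L)\subseteq L:\mathfrak m$ for all ideals $K$ of $R$ generated by a system of parameters and all ideals $L\supseteq K$ (as $R$ is Artinian, only $K=0$ occurs); (3) the inclusion in (2) holds for all ideals $K$ generated by a system of parameters that are not contained in any member of $P$ and all ideals $L\supseteq K$, where $P$ is any given finite (or countable, if $R$ is complete or its residue field is uncountable) set of primes of $R$ different from $\mathfrak m$; (4) $R$ is isomorphic, as a $k$-algebra, to $k[x_1,\dots,x_m]/I'$ for some $m$ and some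 ideal $I'$ in the list below; (5) $R$ is isomorphic, as a ring, to $k[x_1,\dots,x_m]/I'$ for some $m$ and some ideal $I'$ in the list below. The list consists of the following ideals $I'$ of $k[x_1,\dots,x_m]$, where all exponents $a,b,a_i,b_i,c_i$ are positive integers: 1. the Teter ideals $I'=(x_1^{a_1},\dots,x_m^{a_m},\,x_1^{a_1-1}\cdots x_m^{a_m-1})$; 2. $I'=J_1'\cap J_2'\cap J_3'$ with $J_1'=(x_1^a,x_2^b,x_3^{c_3},\dots,x_m^{c_m})$, $J_2'=(x_1^{a+1},x_2,x_3,\dots,x_m)$, $J_3'=(x_1,x_2^{b+1},x_3,\dots,x_m)$, where $m\ge3$ and $c_3,\dots,c_m>1$; 3. $I'=J_1'\cap J_2'\cap J_3'$ with $J_1'=(x_1^a,x_2^{b+1},x_3,\dots,x_m)$, $J_2'=(x_1^{a+1},x_2^b,x_3,\dots,x_m)$, $J_3'=(x_1,x_2,x_3^{c_3},\dots,x_m^{c_m})$, where $m\ge2$; 4. $I'=J_1'\cap J_2'\cap J_3'$ with $J_1'=(x_1^a,x_2,\dots,x_s,x_{s+1}^{b_{s+1}},\dots,x_m^{b_m})$,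 $J_2'=(x_1^{a+1},x_2,\dots,x_m)$, $J_3'=(x_1,x_2^{c_2},\dots,x_s^{c_s},x_{s+1},\dots,x_m)$, for some $1\le s\le m$; 5. $I'=J_1'\cap J_2'\cap J_3'$ with $J_1'=(x_1,\dots,x_t,x_{t+1}^{c_{t+1}},\dots,x_m^{c_m})$, $J_2'=(x_1,\dots,x_s,x_{s+1}^{b_{s+1}},\dots,x_t^{b_t},x_{t+1},\dots,x_m)$, $J_3'=(x_1^{a_1},\dots,x_s^{a_s},x_{s+1},\dots,x_m)$, for some $0\le s\le t\le m$. -/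

import Mathlib

universe u

namespace AlmostGorenstein

/-! ### Local rings: canonical module, trace ideal, type, and the three conditions -/

section LocalRing

variable (R : Type u) [CommRing R] [IsLocalRing R]

/-- `ω` is a canonical module of the Artinian local ring `R`, i.e. an injective hull of the
residue field: `ω` is an injective module which contains a copy of the residue field meeting
every nonzero submodule of `ω` nontrivially. -/
structure IsCanonicalModule (ω : Type u) [AddCommGroup ω] [Module R ω] : Prop where
  injective : Module.Injective R ω
  essential : ∃ ι : IsLocalRing.ResidueField R →ₗ[R] ω, Function.Injective ι ∧
    ∀ N : Submodule R ω, N ⊓ LinearMap.range ι = ⊥ → N = ⊥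

/-- The trace ideal `ω^*(ω)`: the ideal of `R` generated by all `f x` with `x ∈ ω` and
`f : ω → R` an `R`-linear map. -/
def traceIdeal (ω : Type u) [AddCommGroup ω] [Module R ω] : Ideal R :=
  ⨆ f : ω →ₗ[R] R, LinearMap.range f

/-- The Cohen-Macaulay type of an Artinian local ring: the dimension of its socle
`{r | 𝔪 r = 0}` over the residue field `R ⧸ 𝔪`. -/
noncomputable def cmType : ℕ :=
  Module.finrank (R ⧸ IsLocalRing.maximalIdeal R)
    (Submodule.torsionBySet R R (IsLocalRing.maximalIdeal R : Set R))

variable {R} in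
/-- `K` is generated by a system of parameters of `R`: it is generated by `dim R` elements and
its radical is the maximal ideal. -/
def IsParameterIdeal (K : Ideal R) : Prop :=
  ∃ (d : ℕ) (x : Fin d → R), (d : WithBot ℕ∞) = ringKrullDim R ∧
    K = Ideal.span (Set.range x) ∧ K.radical = IsLocalRing.maximalIdeal R

/-- First condition: `𝔪 ⊆ ω^*(ω)`. -/
def Condition1 (ω : Type u) [AddCommGroup ω] [Module R ω] : Prop :=
  IsLocalRing.maximalIdeal R ≤ traceIdeal R ω

/-- Second condition: `K : (K : I) ⊆ I : 𝔪` for all ideals `K` generated by a system of parameters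
and all ideals `I ⊇ K`. -/
def Condition2 : Prop :=
  ∀ K I : Ideal R, IsParameterIdeal K → K ≤ I →
    K.colon ((K.colon (I : Set R) : Ideal R) : Set R) ≤
      I.colon (IsLocalRing.maximalIdeal R : Set R)

variable {R} in
/-- The sets of primes that may be avoided in the third condition: finite sets (or countable ones, if
`R` is complete or its residue field is uncountable) of primes different from the maximal
ideal. -/
def AdmissiblePrimes (P : Set (PrimeSpectrum R)) : Prop :=
  (P.Finite ∨ (P.Countable ∧ (IsAdicComplete (IsLocalRing.maximalIdeal R) R ∨
    Uncountable (IsLocalRing.ResidueField R)))) ∧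
  ∀ p ∈ P, p.asIdeal ≠ IsLocalRing.maximalIdeal R

variable {R} in
/-- Third condition, for a given set `P` of primes: `K : (K : I) ⊆ I : 𝔪` for all ideals `K`
generated by a system of parameters and not contained in any prime of `P`, and all ideals
`I ⊇ K`. -/
def Condition3 (P : Set (PrimeSpectrum R)) : Prop :=
  ∀ K I : Ideal R, IsParameterIdeal K → (∀ p ∈ P, ¬ K ≤ p.asIdeal) → K ≤ I →
    K.colon ((K.colon (I : Set R) : Ideal R) : Set R) ≤
      I.colon (IsLocalRing.maximalIdeal R : Set R)

end LocalRing

/-! ### Monomial ideals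

The variables `x_1, …, x_n` are `X 0, …, X (n - 1)`, indexed by `Fin n`. -/

section Monomial

variable (k : Type u) [Field k] {n : ℕ}

/-- The irreducible monomial ideal `(x_1^{b_1}, …, x_n^{b_n})`, with all exponents positive. -/
noncomputable def powerIdeal (b : Fin n → ℕ+) : Ideal (MvPolynomial (Fin n) k) :=
  Ideal.span (Set.range fun i => (MvPolynomial.X i : MvPolynomial (Fin n) k) ^ (b i : ℕ))

/-- The intersection of three irreducible monomial ideals; row `i` of `a` is the list of exponents
of the `i`-th ideal. -/
noncomputable def tripleIdeal (a : Fin 3 → Fin n → ℕ+) : Ideal (MvPolynomial (Fin n) k) :=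
  powerIdeal k (a 0) ⊓ powerIdeal k (a 1) ⊓ powerIdeal k (a 2)

theorem powerIdeal_le_ker (b : Fin n → ℕ+) :
    powerIdeal k b ≤ RingHom.ker (MvPolynomial.constantCoeff (σ := Fin n) (R := k)) := by
  rw [powerIdeal, Ideal.span_le]
  rintro _ ⟨i, rfl⟩
  simp [RingHom.mem_ker]

theorem ker_le_radical_tripleIdeal (a : Fin 3 → Fin n → ℕ+) :
    RingHom.ker (MvPolynomial.constantCoeff (σ := Fin n) (R := k)) ≤
      (tripleIdeal k a).radical := by
  have hX : ∀ i, (MvPolynomial.X i : MvPolynomial (Fin n) k) ∈ (tripleIdeal k a).radical := by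
    intro i
    have h : ∀ j, (MvPolynomial.X i : MvPolynomial (Fin n) k) ∈ (powerIdeal k (a j)).radical :=
      fun j => ⟨a j i, Ideal.subset_span ⟨i, rfl⟩⟩
    simp only [tripleIdeal, Ideal.radical_inf]
    exact ⟨⟨h 0, h 1⟩, h 2⟩
  have h : ∀ p : MvPolynomial (Fin n) k,
      p - MvPolynomial.C (MvPolynomial.constantCoeff p) ∈ (tripleIdeal k a).radical := by
    intro p
    induction p using MvPolynomial.induction_on with
    | C c => simp
    | add p q hp hq =>
      have := add_mem hp hq
      rwa [sub_add_sub_comm, ← map_add, ← map_add] at this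
    | mul_X p i _ =>
      simpa using Ideal.mul_mem_left _ p (hX i)
  intro p hp
  have := h p
  rwa [RingHom.mem_ker.mp hp, map_zero, sub_zero] at this

instance isLocalRing_quotient (a : Fin 3 → Fin n → ℕ+) :
    IsLocalRing (MvPolynomial (Fin n) k ⧸ tripleIdeal k a) := by
  have hle : tripleIdeal k a ≤
      RingHom.ker (MvPolynomial.constantCoeff (σ := Fin n) (R := k)) :=
    inf_le_right.trans (powerIdeal_le_ker k (a 2))
  have : Nontrivial (MvPolynomial (Fin n) k ⧸ tripleIdeal k a) := by
    refine Ideal.Quotient.nontrivial_iff.mpr fun h => ?_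
    have h1 : (1 : MvPolynomial (Fin n) k) ∈ tripleIdeal k a := h ▸ Submodule.mem_top
    simpa [RingHom.mem_ker] using hle h1
  have hnil : ∀ p : MvPolynomial (Fin n) k, MvPolynomial.constantCoeff p = 0 →
      IsNilpotent (Ideal.Quotient.mk (tripleIdeal k a) p) := by
    intro p hp
    obtain ⟨m, hm⟩ := ker_le_radical_tripleIdeal k a hp
    exact ⟨m, by rw [← map_pow]; exact Ideal.Quotient.eq_zero_iff_mem.mpr hm⟩
  refine IsLocalRing.of_isUnit_or_isUnit_one_sub_self fun r => ?_
  obtain ⟨p, rfl⟩ := Ideal.Quotient.mk_surjective r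
  by_cases hp : MvPolynomial.constantCoeff p = 0
  · exact Or.inr (hnil p hp).isUnit_one_sub
  · left
    have h0 := hnil (p - MvPolynomial.C (MvPolynomial.constantCoeff p)) (by simp)
    have hu : IsUnit (Ideal.Quotient.mk (tripleIdeal k a)
        (MvPolynomial.C (MvPolynomial.constantCoeff p))) :=
      ((isUnit_iff_ne_zero.mpr hp).map MvPolynomial.C).map _
    have := h0.isUnit_add_left_of_commute hu (Commute.all _ _)
    rwa [← map_add, add_sub_cancel] at this

variable {k}

/-- A Teter ideal `(x_1^{a_1}, …, x_n^{a_n}, x_1^{a_1 - 1} ⋯ x_n^{a_n - 1})`. -/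
def IsTeterIdeal (I : Ideal (MvPolynomial (Fin n) k)) : Prop :=
  ∃ a : Fin n → ℕ+,
    I = powerIdeal k a ⊔ Ideal.span {∏ i, MvPolynomial.X i ^ ((a i : ℕ) - 1)}

/-- The ideals `J_1 ∩ J_2 ∩ J_3` with
`J_1 = (x_1^a, x_2^b, x_3^{c_3}, …, x_n^{c_n})`,
`J_2 = (x_1^{a+1}, x_2, x_3, …, x_n)`,
`J_3 = (x_1, x_2^{b+1}, x_3, …, x_n)`,
where `n ≥ 3` and `c_3, …, c_n > 1`. -/
def IsPatternA (I : Ideal (MvPolynomial (Fin n) k)) : Prop :=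
  ∃ (a b : ℕ+) (c : Fin n → ℕ+), 3 ≤ n ∧ (∀ i : Fin n, 2 ≤ (i : ℕ) → 1 < c i) ∧
    I = tripleIdeal k
      ![fun i => if (i : ℕ) = 0 then a else if (i : ℕ) = 1 then b else c i,
        fun i => if (i : ℕ) = 0 then a + 1 else 1,
        fun i => if (i : ℕ) = 1 then b + 1 else 1]

/-- The ideals `J_1 ∩ J_2 ∩ J_3` with
`J_1 = (x_1^a, x_2^{b+1}, x_3, …, x_n)`,
`J_2 = (x_1^{a+1}, x_2^b, x_3, …, x_n)`,
`J_3 = (x_1, x_2, x_3^{c_3}, …, x_n^{c_n})`, where `n ≥ 2`. -/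
def IsPatternB (I : Ideal (MvPolynomial (Fin n) k)) : Prop :=
  ∃ (a b : ℕ+) (c : Fin n → ℕ+), 2 ≤ n ∧
    I = tripleIdeal k
      ![fun i => if (i : ℕ) = 0 then a else if (i : ℕ) = 1 then b + 1 else 1,
        fun i => if (i : ℕ) = 0 then a + 1 else if (i : ℕ) = 1 then b else 1,
        fun i => if (i : ℕ) = 0 then 1 else if (i : ℕ) = 1 then 1 else c i]

/-- The ideals `J_1 ∩ J_2 ∩ J_3` with
`J_1 = (x_1^a, x_2, …, x_s, x_{s+1}^{b_{s+1}}, …, x_n^{b_n})`,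
`J_2 = (x_1^{a+1}, x_2, …, x_n)`,
`J_3 = (x_1, x_2^{c_2}, …, x_s^{c_s}, x_{s+1}, …, x_n)`. -/
def IsPatternC (I : Ideal (MvPolynomial (Fin n) k)) : Prop :=
  ∃ (s : ℕ) (a : ℕ+) (b c : Fin n → ℕ+), 1 ≤ s ∧ s ≤ n ∧
    I = tripleIdeal k
      ![fun i => if (i : ℕ) = 0 then a else if (i : ℕ) < s then 1 else b i,
        fun i => if (i : ℕ) = 0 then a + 1 else 1,
        fun i => if (i : ℕ) = 0 then 1 else if (i : ℕ) < s then c i else 1]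

/-- The ideals `J_1 ∩ J_2 ∩ J_3` with
`J_1 = (x_1, …, x_t, x_{t+1}^{c_{t+1}}, …, x_n^{c_n})`,
`J_2 = (x_1, …, x_s, x_{s+1}^{b_{s+1}}, …, x_t^{b_t}, x_{t+1}, …, x_n)`,
`J_3 = (x_1^{a_1}, …, x_s^{a_s}, x_{s+1}, …, x_n)`. -/
def IsPatternD (I : Ideal (MvPolynomial (Fin n) k)) : Prop :=
  ∃ (s t : ℕ) (a b c : Fin n → ℕ+), s ≤ t ∧ t ≤ n ∧
    I = tripleIdeal k
      ![fun i => if (i : ℕ) < t then 1 else c i,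
        fun i => if (i : ℕ) < s then 1 else if (i : ℕ) < t then b i else 1,
        fun i => if (i : ℕ) < s then a i else 1]

/-- `I` is one of the ideals of the classification. -/
def IsListed (I : Ideal (MvPolynomial (Fin n) k)) : Prop :=
  IsTeterIdeal I ∨ IsPatternA I ∨ IsPatternB I ∨ IsPatternC I ∨ IsPatternD I

end Monomial

end AlmostGorenstein

/-! The nonzero monomials of `R` are those whose exponent lies below one of three vectors `α i`,
namely row `i` of `a` lowered by one in every entry; the whole proof is about these vectors. The
maximal ideal is nilpotent with residue field `k`, so `Hom_k(R, k)` is a canonical module and all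
others are isomorphic to it. Moreover `0` is the only parameter ideal, and the set `P` is
necessarily empty.

Condition (1) implies (2) because, for `r` in `0 : (0 : L)`, injectivity of `ω` gives `r ω ⊆ L ω`,
hence `r f(ω) ⊆ L` for every `f : ω → R` (`mul_apply_mem_of_mem_colon_colon`). Condition (3) is a
special case of (2).

From (3) to (4), only principal ideals generated by a monomial are needed: they turn the condition
into inequalities between exponents (`IsMonomialQuotient.le_of_condition3`). Type three makes the
vectors an antichain (`IsMonomialQuotient.antichain_of_cmType`). The inequalities then give each
coordinate a hub, a vector which any other vector positive there exceeds only in that coordinate,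
and there by exactly one (`hasHubs_of_forall`). Analysing the coordinates shared by two vectors
leaves five shapes (`exists_shape`), one degenerate corner being excluded separately
(`exists_pos_of_forall`). Permuting variables and dropping ones that are zero in `R` produces the
list.

From (5) to (1), each nonzero `x_l` is hit by a homogeneous map `ω → R` which sends the dual basis
vector of `x^u` to `x^(d - u)`, where `d` is a standard exponent plus `e_l`. Linearity is a
combinatorial condition on `d` (`IsMonomialQuotient.homogMap_smul`), checked through `IsTraceHub`
for the intersections and directly for Teter ideals. -/

namespace AlmostGorenstein

/-! ### Injective modules and the biannihilator of an ideal -/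

section Injective

variable {R : Type u} [CommRing R] {ω : Type u} [AddCommGroup ω] [Module R ω]

/-- If `r` kills the annihilator of a finitely generated ideal `L`, then every linear map from an
injective module to `R` maps `r • ω` into `L`. -/
theorem mul_apply_mem_of_mem_colon_colon (hω : Module.Injective R ω) {L : Ideal R} (hL : L.FG)
    {r : R}
    (hr : r ∈ (⊥ : Ideal R).colon (((⊥ : Ideal R).colon (L : Set R) : Ideal R) : Set R))
    (f : ω →ₗ[R] R) (x : ω) : r * f x ∈ L := by
  obtain ⟨s, rfl⟩ := hL
  classical
  -- The kernel of `c ↦ (c l)_l` is `0 : L`, which kills `r • x`. So `c ↦ c r x` is defined on `R ⧸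
  -- (0 : L)`, a submodule of `R^s`, and extends to `R^s → ω`; evaluating at `g 1` shows `r x ∈ L
  -- ω`.
  let g : R →ₗ[R] (s → R) := LinearMap.pi fun l => LinearMap.toSpanSingleton R R (l : R)
  have hg : ∀ c, c ∈ LinearMap.ker g ↔ ∀ l : s, c * l = 0 := fun c => by
    simp [g, LinearMap.mem_ker, funext_iff]
  let h : R →ₗ[R] ω := LinearMap.toSpanSingleton R ω (r • x)
  have hgh : LinearMap.ker g ≤ LinearMap.ker h := by
    intro c hc
    have hc' : c ∈ (⊥ : Ideal R).colon ((Ideal.span (s : Set R) : Ideal R) : Set R) := by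
      rw [Submodule.mem_colon]
      intro y hy
      have : Ideal.span (s : Set R) ≤ (Ideal.span {c}).annihilator := by
        refine Ideal.span_le.mpr fun l hl => ?_
        rw [SetLike.mem_coe, Submodule.mem_annihilator_span_singleton, smul_eq_mul, mul_comm]
        exact (hg c).mp hc ⟨l, hl⟩
      have := this hy
      rw [Submodule.mem_annihilator_span_singleton, smul_eq_mul, mul_comm] at this
      simpa using this
    have := Submodule.mem_colon.mp hr c hc'
    simp only [smul_eq_mul, Ideal.mem_bot] at this
    simp [h, LinearMap.mem_ker, smul_smul, mul_comm c r, this]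
  obtain ⟨e, he⟩ := hω.out ((LinearMap.ker g).liftQ g le_rfl)
    (LinearMap.ker_eq_bot.mp (Submodule.ker_liftQ_eq_bot _ _ _ le_rfl))
    ((LinearMap.ker g).liftQ h hgh)
  have h1 : e (g 1) = r • x := by
    have := he (Submodule.Quotient.mk 1)
    rw [Submodule.liftQ_apply, Submodule.liftQ_apply] at this
    simpa [h] using this
  have h2 : g 1 = ∑ l : s, (l : R) • Pi.single l (1 : R) := by
    ext i
    simp [g, Finset.sum_apply, Pi.single_apply]
  rw [← smul_eq_mul, ← map_smul, ← h1, h2, map_sum, map_sum]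
  refine Ideal.sum_mem _ fun l _ => ?_
  rw [map_smul, map_smul, smul_eq_mul]
  exact Ideal.mul_mem_right _ _ (Ideal.subset_span l.2)

theorem traceIdeal_mul_colon_colon_le (hω : Module.Injective R ω) {L : Ideal R} (hL : L.FG)
    {r t : R}
    (hr : r ∈ (⊥ : Ideal R).colon (((⊥ : Ideal R).colon (L : Set R) : Ideal R) : Set R))
    (ht : t ∈ traceIdeal R ω) : r * t ∈ L := by
  have h : traceIdeal R ω ≤ L.colon {r} := by
    refine iSup_le fun f => ?_
    rintro _ ⟨x, rfl⟩
    rw [Submodule.mem_colon_singleton, smul_eq_mul, mul_comm]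
    exact mul_apply_mem_of_mem_colon_colon hω hL hr f x
  have := h ht
  rwa [Submodule.mem_colon_singleton, smul_eq_mul, mul_comm] at this

theorem traceIdeal_le_of_equiv {ω' : Type u} [AddCommGroup ω'] [Module R ω'] (e : ω ≃ₗ[R] ω') :
    traceIdeal R ω ≤ traceIdeal R ω' := by
  refine iSup_le fun f => ?_
  rintro _ ⟨x, rfl⟩
  refine Submodule.mem_iSup_of_mem (f ∘ₗ e.symm.toLinearMap) ⟨e x, by simp⟩

variable [IsLocalRing R]

/-- Two canonical modules are isomorphic. -/
theorem IsCanonicalModule.nonempty_equiv (hω : IsCanonicalModule R ω) {ω' : Type u}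
    [AddCommGroup ω'] [Module R ω'] (hω' : IsCanonicalModule R ω') : Nonempty (ω ≃ₗ[R] ω') := by
  obtain ⟨ι, hι, hess⟩ := hω.essential
  obtain ⟨ι', hι', hess'⟩ := hω'.essential
  have extend : ∃ g : ω →ₗ[R] ω', ∀ x, g (ι x) = ι' x := by
    let r := LinearEquiv.ofInjective ι hι
    obtain ⟨g, hg⟩ := hω'.injective.out (LinearMap.range ι).subtype
      (Submodule.injective_subtype _) (ι' ∘ₗ r.symm.toLinearMap)
    exact ⟨g, fun x => by simpa [r] using hg (r x)⟩
  obtain ⟨g, hg⟩ := extend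
  have hginj : Function.Injective g := by
    rw [← LinearMap.ker_eq_bot]
    refine hess _ ?_
    rw [eq_bot_iff]
    rintro _ ⟨hx, y, rfl⟩
    have h0 : ι' y = 0 := by rw [← hg]; exact hx
    rw [(map_eq_zero_iff ι' hι').mp h0]
    simp
  -- A retraction of `g` is injective by essentiality on the other side, which forces `g` to be
  -- surjective.
  obtain ⟨p, hp⟩ := hω.injective.out g hginj LinearMap.id
  have hker : LinearMap.ker p = ⊥ := by
    refine hess' _ ?_
    rw [eq_bot_iff]
    rintro _ ⟨hx, y, rfl⟩
    have h0 : ι y = 0 := by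
      have : p (ι' y) = 0 := hx
      rwa [← hg, hp] at this
    rw [(map_eq_zero_iff ι hι).mp h0]
    simp
  refine ⟨LinearEquiv.ofBijective g ⟨hginj, fun y => ⟨p y, ?_⟩⟩⟩
  exact LinearMap.ker_eq_bot.mp hker (by simpa using hp (p y))

end Injective

/-! ### The dual of a local algebra -/

/-- The `k`-linear dual of a `k`-algebra, as a module over the algebra. -/
def DualModule (k R : Type u) [Field k] [CommRing R] [Algebra k R] : Type u := R →ₗ[k] k

namespace DualModule

variable {k R : Type u} [Field k] [CommRing R] [Algebra k R]

instance : AddCommGroup (DualModule k R) := inferInstanceAs (AddCommGroup (R →ₗ[k] k))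

/-- The functional underlying an element of the dual. -/
def toFun (φ : DualModule k R) : R →ₗ[k] k := φ

instance : SMul R (DualModule k R) := ⟨fun r φ => φ.toFun ∘ₗ LinearMap.mulLeft k r⟩

theorem toFun_smul (r s : R) (φ : DualModule k R) : (r • φ).toFun s = φ.toFun (r * s) := rfl

theorem toFun_add (φ ψ : DualModule k R) : (φ + ψ).toFun = φ.toFun + ψ.toFun := rfl

theorem toFun_zero : (0 : DualModule k R).toFun = 0 := rfl

theorem ext_toFun {φ ψ : DualModule k R} (h : ∀ s, φ.toFun s = ψ.toFun s) : φ = ψ :=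
  LinearMap.ext h

instance : Module R (DualModule k R) where
  one_smul φ := ext_toFun fun s => by simp [toFun_smul]
  mul_smul r s φ := ext_toFun fun t => by simp only [toFun_smul]; congr 1; ring
  smul_zero r := ext_toFun fun s => by simp [toFun_smul, toFun_zero]
  smul_add r φ ψ := ext_toFun fun s => by simp [toFun_smul, toFun_add]
  add_smul r s φ := ext_toFun fun t => by simp [toFun_smul, toFun_add, add_mul]
  zero_smul φ := ext_toFun fun s => by simp [toFun_smul, toFun_zero]

/-- By adjunction, an `R`-linear map into the dual is the same as a `k`-linear functional, obtained
by evaluating at `1`. Functionals extend along injections because these split over `k`. -/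
theorem injective : Module.Injective R (DualModule k R) := by
  refine ⟨fun X Y _ _ _ _ f hf g => ?_⟩
  let _ : Module k X := Module.compHom X (algebraMap k R)
  let _ : Module k Y := Module.compHom Y (algebraMap k R)
  have hX : ∀ (c : k) (x : X), c • x = algebraMap k R c • x := fun _ _ => rfl
  have hY : ∀ (c : k) (y : Y), c • y = algebraMap k R c • y := fun _ _ => rfl
  let f' : X →ₗ[k] Y :=
    { toFun := f, map_add' := map_add f, map_smul' := fun c x => by simp [hX, hY] }
  obtain ⟨p, hp⟩ := LinearMap.exists_leftInverse_of_injective f' (LinearMap.ker_eq_bot.mpr hf)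
  let g' : X →ₗ[k] k :=
    { toFun := fun x => (g x).toFun 1
      map_add' := fun x y => by rw [map_add, toFun_add, LinearMap.add_apply]
      map_smul' := fun c x => by
        rw [hX, map_smul, toFun_smul, mul_one, Algebra.algebraMap_eq_smul_one, map_smul]
        rfl }
  let h : Y →ₗ[R] DualModule k R :=
    { toFun := fun y => (show R →ₗ[k] k from
        { toFun := fun r => g' (p (r • y))
          map_add' := fun r s => by rw [add_smul, map_add, map_add]
          map_smul' := fun c r => by
            have : (c • r) • y = c • r • y := by rw [hY, smul_smul, Algebra.smul_def]
            rw [this, map_smul, map_smul]; rfl })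
      map_add' := fun y z => ext_toFun fun s => by
        change g' (p (s • (y + z))) = g' (p (s • y)) + g' (p (s • z))
        rw [smul_add, map_add, map_add]
      map_smul' := fun r y => ext_toFun fun s => by
        change g' (p (s • r • y)) = g' (p ((r * s) • y))
        rw [smul_smul, mul_comm] }
  refine ⟨h, fun x => ext_toFun fun s => ?_⟩
  change g' (p (s • f x)) = _
  have h1 : p (s • f x) = s • x := by
    rw [← map_smul]
    exact LinearMap.congr_fun hp (s • x)
  rw [h1]
  change (g (s • x)).toFun 1 = _
  rw [map_smul, toFun_smul, mul_one]

open IsLocalRing in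
/-- The dual of a local `k`-algebra with nilpotent maximal ideal and residue field `k` is a
canonical module. -/
theorem isCanonicalModule [IsLocalRing R] (hk : ∀ r : R, ∃ c : k, r - algebraMap k R c ∈
    maximalIdeal R) (hnil : IsNilpotent (maximalIdeal R)) :
    IsCanonicalModule R (DualModule k R) := by
  refine ⟨injective, ?_⟩
  -- A functional `χ` that kills the maximal ideal but not `1` spans the copy of the residue field.
  obtain ⟨χ₀, h1, h2⟩ := Submodule.exists_le_ker_of_notMem
    (p := (maximalIdeal R).restrictScalars k) (v := (1 : R))
    (fun h => (Ideal.ne_top_iff_one _).mp (maximalIdeal.isMaximal R).ne_top h)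
  let χ : DualModule k R := χ₀
  have hχ : ∀ r ∈ maximalIdeal R, χ.toFun r = 0 := fun r hr => h2 hr
  have hχ1 : χ.toFun 1 ≠ 0 := h1
  have hker : ∀ r : R, r • χ = 0 ↔ r ∈ maximalIdeal R := by
    refine fun r => ⟨fun h => ?_, fun h => ext_toFun fun s => ?_⟩
    · by_contra hr
      obtain ⟨u, rfl⟩ := notMem_maximalIdeal.mp hr
      apply hχ1
      have := congrArg (fun ψ : DualModule k R => ψ.toFun (↑u⁻¹ : R)) h
      simpa [toFun_smul, toFun_zero] using this
    · rw [toFun_smul, toFun_zero]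
      exact hχ _ (Ideal.mul_mem_right _ _ h)
  -- The socle of the dual is spanned by `χ`: since `R = k + 𝔪`, a functional vanishing on `𝔪` is
  -- determined by its value at `1`.
  have hsoc : ∀ g : DualModule k R, (∀ r ∈ maximalIdeal R, r • g = 0) → ∃ c : R, g = c • χ := by
    intro g hg
    refine ⟨algebraMap k R (g.toFun 1 / χ.toFun 1), ext_toFun fun s => ?_⟩
    obtain ⟨c, hc⟩ := hk s
    have e1 : ∀ ψ : DualModule k R, ψ.toFun s = ψ.toFun (s - algebraMap k R c) + c * ψ.toFun 1 := by
      intro ψ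
      have : s = (s - algebraMap k R c) + c • (1 : R) := by
        rw [Algebra.smul_def, mul_one, sub_add_cancel]
      conv_lhs => rw [this]
      rw [map_add, map_smul, smul_eq_mul]
    have e2 : g.toFun (s - algebraMap k R c) = 0 := by
      have := congrArg (fun ψ : DualModule k R => ψ.toFun 1) (hg _ hc)
      simpa [toFun_smul, toFun_zero] using this
    rw [toFun_smul, ← Algebra.smul_def, map_smul, e1 g, e1 χ, e2, hχ _ hc, smul_eq_mul]
    field_simp
    ring
  obtain ⟨ι, hι⟩ : ∃ ι : ResidueField R →ₗ[R] DualModule k R, ∀ r, ι (residue R r) = r • χ :=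
    ⟨(maximalIdeal R).liftQ (LinearMap.toSpanSingleton R _ χ) fun r hr => by
      simpa [LinearMap.mem_ker] using (hker r).mpr hr, fun r => rfl⟩
  refine ⟨ι, ?_, ?_⟩
  · rw [injective_iff_map_eq_zero]
    intro x hx
    obtain ⟨r, rfl⟩ := residue_surjective x
    rw [hι, hker] at hx
    rwa [residue_eq_zero_iff]
  · intro N hN
    by_contra hne
    obtain ⟨x, hxN, hx0⟩ := Submodule.exists_mem_ne_zero_of_ne_bot hne
    have hex : ∃ m : ℕ, ∀ r ∈ maximalIdeal R ^ m, r • x = 0 := by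
      obtain ⟨m, hm⟩ := hnil
      refine ⟨m, fun r hr => ?_⟩
      rw [hm] at hr
      rw [(Submodule.mem_bot R).mp hr, zero_smul]
    classical
    -- With the least power of `𝔪` that kills `x`, a multiple of `x` by the preceding power is a
    -- nonzero socle element.
    obtain ⟨m, hm, hmin⟩ : ∃ m, (∀ r ∈ maximalIdeal R ^ m, r • x = 0) ∧
        ∀ j < m, ¬ ∀ r ∈ maximalIdeal R ^ j, r • x = 0 :=
      ⟨Nat.find hex, Nat.find_spec hex, fun j hj => Nat.find_min hex hj⟩
    cases m with
    | zero => exact hx0 (by simpa using hm 1 (by simp))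
    | succ m =>
      obtain ⟨r, hr, hrx⟩ : ∃ r ∈ maximalIdeal R ^ m, r • x ≠ 0 := by
        simpa using hmin m (Nat.lt_succ_self m)
      obtain ⟨c, hc⟩ := hsoc (r • x) fun s hs => by
        rw [smul_smul]
        exact hm _ (by rw [pow_succ']; exact Ideal.mul_mem_mul hs hr)
      have : r • x ∈ (⊥ : Submodule R (DualModule k R)) := by
        rw [← hN]
        exact ⟨N.smul_mem _ hxN, ⟨residue R c, by rw [hc, hι]⟩⟩
      exact hrx ((Submodule.mem_bot R).mp this)

end DualModule

/-! ### Local rings with nilpotent maximal ideal -/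

section Nilpotent

open IsLocalRing

variable {R : Type u} [CommRing R] [IsLocalRing R]

theorem eq_maximalIdeal_of_isNilpotent (h : IsNilpotent (maximalIdeal R)) (p : Ideal R)
    [hp : p.IsPrime] : p = maximalIdeal R := by
  obtain ⟨m, hm⟩ := h
  refine le_antisymm (le_maximalIdeal hp.ne_top) ?_
  exact hp.le_of_pow_le (n := m) (by rw [hm]; exact bot_le)

theorem ringKrullDim_eq_zero_of_isNilpotent (h : IsNilpotent (maximalIdeal R)) :
    ringKrullDim R = 0 := by
  rw [← ringKrullDimZero_iff_ringKrullDim_eq_zero, Ring.krullDimLE_zero_iff]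
  intro p hp
  rw [eq_maximalIdeal_of_isNilpotent h p]
  exact maximalIdeal.isMaximal R

theorem isParameterIdeal_iff_of_isNilpotent (h : IsNilpotent (maximalIdeal R)) (K : Ideal R) :
    IsParameterIdeal K ↔ K = ⊥ := by
  constructor
  · rintro ⟨d, x, hd, rfl, -⟩
    rw [ringKrullDim_eq_zero_of_isNilpotent h] at hd
    have hd0 : d = 0 := by exact_mod_cast hd
    subst hd0
    simp
  · rintro rfl
    refine ⟨0, Fin.elim0, by simp [ringKrullDim_eq_zero_of_isNilpotent h], by simp, ?_⟩
    refine le_antisymm (le_maximalIdeal ?_) ?_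
    · rw [Ne, Ideal.radical_eq_top]
      exact bot_ne_top
    · obtain ⟨m, hm⟩ := h
      exact fun r hr => ⟨m, by
        have := Ideal.pow_mem_pow hr m
        rwa [hm] at this⟩

theorem Condition1.condition2 {ω : Type u} [AddCommGroup ω] [Module R ω] [IsNoetherianRing R]
    (h : IsNilpotent (maximalIdeal R)) (hω : Module.Injective R ω) (h1 : Condition1 R ω) :
    Condition2 R := by
  intro K L hK _ r hr
  rw [(isParameterIdeal_iff_of_isNilpotent h K).mp hK] at hr
  rw [Submodule.mem_colon]
  exact fun t ht => traceIdeal_mul_colon_colon_le hω (IsNoetherian.noetherian L) hr (h1 ht)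

theorem Condition2.condition3 (h : Condition2 R) (P : Set (PrimeSpectrum R)) : Condition3 P :=
  fun K I hK _ => h K I hK

/-- The maximal ideal is the only prime, so an admissible `P` has no members and `K = 0` is allowed.
-/
theorem Condition3.mul_mem (h : IsNilpotent (maximalIdeal R)) {P : Set (PrimeSpectrum R)}
    (hP : AdmissiblePrimes P) (h3 : Condition3 P) {L : Ideal R} {r t : R}
    (hr : r ∈ (⊥ : Ideal R).colon (((⊥ : Ideal R).colon (L : Set R) : Ideal R) : Set R))
    (ht : t ∈ maximalIdeal R) : r * t ∈ L := by
  have := h3 ⊥ L ((isParameterIdeal_iff_of_isNilpotent h ⊥).mpr rfl)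
    (fun p hp => absurd (eq_maximalIdeal_of_isNilpotent h p.asIdeal) (hP.2 p hp)) bot_le hr
  exact Submodule.mem_colon.mp this t ht

end Nilpotent

/-! ### Quotients by monomial ideals -/

open MvPolynomial

section MonomialQuotient

/-- `π` presents `R` as the quotient of a polynomial ring by the monomial ideal of finite
colength whose standard monomials are those with exponent in the lower set `U`. -/
structure IsMonomialQuotient {k R : Type u} [Field k] [CommRing R] [Algebra k R] {n : ℕ}
    (π : MvPolynomial (Fin n) k →ₐ[k] R) (U : Set (Fin n →₀ ℕ)) : Prop where
  surjective : Function.Surjective π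
  eq_zero_iff : ∀ p, π p = 0 ↔ ∀ u ∈ U, coeff u p = 0
  lower : IsLowerSet U
  zero_mem : 0 ∈ U
  exists_notMem : ∀ l, ∃ N, Finsupp.single l N ∉ U

namespace IsMonomialQuotient

variable {k R : Type u} [Field k] [CommRing R] [Algebra k R] {n : ℕ}
  {π : MvPolynomial (Fin n) k →ₐ[k] R} {U : Set (Fin n →₀ ℕ)}

theorem monomial_eq_zero_iff (h : IsMonomialQuotient π U) (u : Fin n →₀ ℕ) :
    π (monomial u 1) = 0 ↔ u ∉ U := by
  classical
  rw [h.eq_zero_iff]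
  refine ⟨fun h' hu => by simpa using h' u hu, fun hu v hv => ?_⟩
  rw [coeff_monomial, if_neg]
  rintro rfl
  exact hu hv

theorem isNilpotent_X (h : IsMonomialQuotient π U) (l : Fin n) : IsNilpotent (π (X l)) := by
  obtain ⟨N, hN⟩ := h.exists_notMem l
  refine ⟨N, ?_⟩
  rw [← map_pow, X_pow_eq_monomial]
  exact (h.monomial_eq_zero_iff _).mpr hN

theorem exists_sub_mem_span (h : IsMonomialQuotient π U) (r : R) :
    ∃ c : k, r - algebraMap k R c ∈ Ideal.span (Set.range fun l => π (X l)) := by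
  obtain ⟨p, rfl⟩ := h.surjective r
  refine ⟨constantCoeff p, ?_⟩
  induction p using MvPolynomial.induction_on with
  | C c =>
    have : π (C c) = algebraMap k R c := π.commutes c
    simp [this]
  | add p q hp hq =>
    have := add_mem hp hq
    rwa [sub_add_sub_comm, ← map_add, ← map_add, ← map_add] at this
  | mul_X p l _ =>
    simpa using Ideal.mul_mem_left _ (π p) (Ideal.subset_span (Set.mem_range_self l) :
      π (X l) ∈ Ideal.span (Set.range fun l => π (X l)))

theorem isNoetherianRing (h : IsMonomialQuotient π U) : IsNoetherianRing R :=
  isNoetherianRing_of_surjective _ _ π.toRingHom h.surjective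

theorem isNilpotent_span (h : IsMonomialQuotient π U) :
    IsNilpotent (Ideal.span (Set.range fun l => π (X l))) := by
  have := h.isNoetherianRing
  rw [Ideal.FG.isNilpotent_iff_le_nilradical (IsNoetherian.noetherian _), Ideal.span_le]
  rintro _ ⟨l, rfl⟩
  exact h.isNilpotent_X l

theorem exists_dual (h : IsMonomialQuotient π U) {u : Fin n →₀ ℕ} (hu : u ∈ U) :
    ∃ φ : DualModule k R, ∀ p, φ.toFun (π p) = coeff u p := by
  obtain ⟨s, hs⟩ := π.toLinearMap.exists_rightInverse_of_surjective
    (LinearMap.range_eq_top.mpr h.surjective)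
  refine ⟨lcoeff k u ∘ₗ s, fun p => ?_⟩
  change coeff u (s (π p)) = coeff u p
  have h0 : π (s (π p) - p) = 0 := by
    rw [map_sub, sub_eq_zero]
    exact LinearMap.congr_fun hs (π p)
  have := (h.eq_zero_iff _).mp h0 u hu
  rwa [coeff_sub, sub_eq_zero] at this

/-- The degree `d` map from the dual of a monomial quotient to the quotient, which maps the dual
basis element of `x ^ u` to `x ^ (d - u)`. -/
noncomputable def homogMap (π : MvPolynomial (Fin n) k →ₐ[k] R) (d : Fin n →₀ ℕ)
    (φ : DualModule k R) : R :=
  ∑ x ∈ Finset.HasAntidiagonal.antidiagonal d, φ.toFun (π (monomial x.1 1)) • π (monomial x.2 1)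

theorem homogMap_add (d : Fin n →₀ ℕ) (φ ψ : DualModule k R) :
    homogMap π d (φ + ψ) = homogMap π d φ + homogMap π d ψ := by
  simp [homogMap, DualModule.toFun_add, add_smul, Finset.sum_add_distrib]

/-- Both sides are part of the sum of `φ(x^u) x^w` over `u + w = d + e_t`: the left lacks the terms
with `u t = 0`, the right those with `w t = 0`. The hypothesis, used also with `u` and `w`
exchanged, makes all these terms zero. -/
theorem homogMap_X_smul (h : IsMonomialQuotient π U) {d : Fin n →₀ ℕ} (t : Fin n)
    (hd : ∀ u w : Fin n →₀ ℕ, u + w = d + Finsupp.single t 1 → w t = 0 → u ∈ U → w ∉ U)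
    (φ : DualModule k R) : homogMap π d (π (X t) • φ) = π (X t) * homogMap π d φ := by
  have hX : ∀ u : Fin n →₀ ℕ,
      π (X t) * π (monomial u 1) = π (monomial (u + Finsupp.single t 1) 1) := fun u => by
    rw [← map_mul, mul_comm, X, monomial_mul, one_mul]
  have key : ∀ u : Fin n →₀ ℕ, u t ≠ 0 → u - Finsupp.single t 1 + Finsupp.single t 1 = u := by
    intro u hu
    refine tsub_add_cancel_of_le (Finsupp.single_le_iff.mpr (Nat.one_le_iff_ne_zero.mpr hu))
  have hvan : ∀ x : (Fin n →₀ ℕ) × (Fin n →₀ ℕ),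
      x ∈ Finset.HasAntidiagonal.antidiagonal (d + Finsupp.single t 1) → (x.1 t = 0 ∨ x.2 t = 0) →
      φ.toFun (π (monomial x.1 1)) • π (monomial x.2 1) = 0 := by
    rintro ⟨u, w⟩ hx h0
    rw [Finset.HasAntidiagonal.mem_antidiagonal] at hx
    have : u ∉ U ∨ w ∉ U := by
      by_contra hc
      push Not at hc
      rcases h0 with h0 | h0
      · exact hd w u (by rw [add_comm]; exact hx) h0 hc.2 hc.1
      · exact hd u w hx h0 hc.1 hc.2
    rcases this with hu | hw
    · simp [(h.monomial_eq_zero_iff u).mpr hu]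
    · simp [(h.monomial_eq_zero_iff w).mpr hw]
  have e1 : homogMap π d (π (X t) • φ) = ∑ x ∈ Finset.HasAntidiagonal.antidiagonal (d + Finsupp.single t 1),
      φ.toFun (π (monomial x.1 1)) • π (monomial x.2 1) := by
    refine Finset.sum_of_injOn (fun x => (x.1 + Finsupp.single t 1, x.2)) ?_ ?_ ?_ ?_
    · rintro ⟨u, w⟩ _ ⟨u', w'⟩ _ he
      simpa using he
    · rintro ⟨u, w⟩ hx
      simp only [Finset.mem_coe, Finset.HasAntidiagonal.mem_antidiagonal] at hx ⊢
      rw [← hx]; abel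
    · rintro ⟨u, w⟩ hx hx'
      refine hvan _ hx (Or.inl ?_)
      by_contra hu
      refine hx' ⟨(u - Finsupp.single t 1, w), ?_, by simp [key u hu]⟩
      simp only [Finset.mem_coe, Finset.HasAntidiagonal.mem_antidiagonal] at hx ⊢
      exact add_right_cancel (b := Finsupp.single t 1)
        (by rw [← hx, add_right_comm, key u hu])
    · rintro ⟨u, w⟩ _
      rw [DualModule.toFun_smul, hX]
  have e2 : π (X t) * homogMap π d φ = ∑ x ∈ Finset.HasAntidiagonal.antidiagonal (d + Finsupp.single t 1),
      φ.toFun (π (monomial x.1 1)) • π (monomial x.2 1) := by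
    rw [homogMap, Finset.mul_sum]
    refine Finset.sum_of_injOn (fun x => (x.1, x.2 + Finsupp.single t 1)) ?_ ?_ ?_ ?_
    · rintro ⟨u, w⟩ _ ⟨u', w'⟩ _ he
      simpa using he
    · rintro ⟨u, w⟩ hx
      simp only [Finset.mem_coe, Finset.HasAntidiagonal.mem_antidiagonal] at hx ⊢
      rw [← hx]; abel
    · rintro ⟨u, w⟩ hx hx'
      refine hvan _ hx (Or.inr ?_)
      by_contra hw
      refine hx' ⟨(u, w - Finsupp.single t 1), ?_, by simp [key w hw]⟩
      simp only [Finset.mem_coe, Finset.HasAntidiagonal.mem_antidiagonal] at hx ⊢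
      exact add_right_cancel (b := Finsupp.single t 1)
        (by rw [← hx, add_assoc, key w hw])
    · rintro ⟨u, w⟩ _
      rw [mul_smul_comm, hX]
  rw [e1, e2]

theorem homogMap_smul (h : IsMonomialQuotient π U) {d : Fin n →₀ ℕ}
    (hd : ∀ (t : Fin n) (u w : Fin n →₀ ℕ), u + w = d + Finsupp.single t 1 → w t = 0 →
      u ∈ U → w ∉ U) (r : R) (φ : DualModule k R) :
    homogMap π d (r • φ) = r * homogMap π d φ := by
  obtain ⟨p, rfl⟩ := h.surjective r
  induction p using MvPolynomial.induction_on generalizing φ with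
  | C c =>
    have hc : π (C c) = algebraMap k R c := π.commutes c
    rw [hc, homogMap, homogMap, Finset.mul_sum]
    refine Finset.sum_congr rfl fun x _ => ?_
    rw [DualModule.toFun_smul, ← Algebra.smul_def, ← Algebra.smul_def, map_smul, smul_assoc]
  | add p q hp hq => rw [map_add, add_smul, homogMap_add, hp, hq, add_mul]
  | mul_X p t hp =>
    rw [map_mul, mul_smul, hp, h.homogMap_X_smul t (hd t), mul_assoc]

/-- The map of degree `u + e_l` takes the dual basis vector of `x^u` to `x_l`. -/
theorem X_mem_traceIdeal (h : IsMonomialQuotient π U) {u : Fin n →₀ ℕ} {l : Fin n} (hu : u ∈ U)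
    (hd : ∀ (t : Fin n) (v w : Fin n →₀ ℕ), v + w = u + Finsupp.single l 1 + Finsupp.single t 1 →
      w t = 0 → v ∈ U → w ∉ U) :
    π (X l) ∈ traceIdeal R (DualModule k R) := by
  obtain ⟨φ, hφ⟩ := h.exists_dual hu
  let f : DualModule k R →ₗ[R] R :=
    { toFun := homogMap π (u + Finsupp.single l 1)
      map_add' := homogMap_add _
      map_smul' := fun r φ => h.homogMap_smul hd r φ }
  refine Submodule.mem_iSup_of_mem f ⟨φ, ?_⟩
  change homogMap π (u + Finsupp.single l 1) φ = _
  classical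
  rw [homogMap, Finset.sum_eq_single (u, Finsupp.single l 1)]
  · simp [hφ, X]
  · rintro ⟨v, w⟩ hx hne
    rw [hφ, coeff_monomial, if_neg, zero_smul]
    intro (hv : v = u)
    rw [Finset.HasAntidiagonal.mem_antidiagonal] at hx
    subst hv
    exact hne (Prod.ext rfl (add_left_cancel hx))
  · intro hx
    exact absurd (by rw [Finset.HasAntidiagonal.mem_antidiagonal]) hx

variable [IsLocalRing R]

open IsLocalRing

theorem maximalIdeal_eq (h : IsMonomialQuotient π U) :
    maximalIdeal R = Ideal.span (Set.range fun l => π (X l)) := by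
  have hle : Ideal.span (Set.range fun l => π (X l)) ≤ maximalIdeal R := by
    rw [Ideal.span_le]
    rintro _ ⟨l, rfl⟩
    exact (mem_maximalIdeal _).mpr (h.isNilpotent_X l).not_isUnit
  refine le_antisymm (fun r hr => ?_) hle
  obtain ⟨c, hc⟩ := h.exists_sub_mem_span r
  by_cases hc0 : c = 0
  · simpa [hc0] using hc
  · have h1 := sub_mem hr (hle hc)
    rw [sub_sub_cancel] at h1
    exact absurd ((isUnit_iff_ne_zero.mpr hc0).map (algebraMap k R)) h1

theorem isNilpotent_maximalIdeal (h : IsMonomialQuotient π U) : IsNilpotent (maximalIdeal R) :=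
  h.maximalIdeal_eq.symm ▸ h.isNilpotent_span

theorem isCanonicalModule (h : IsMonomialQuotient π U) :
    IsCanonicalModule R (DualModule k R) :=
  DualModule.isCanonicalModule (h.maximalIdeal_eq.symm ▸ h.exists_sub_mem_span)
    h.isNilpotent_maximalIdeal

/-- A combinatorial criterion for the trace ideal of every canonical module to contain the maximal
ideal. -/
theorem condition1 (h : IsMonomialQuotient π U)
    (hU : ∀ l, Finsupp.single l 1 ∈ U → ∃ u ∈ U, ∀ (t : Fin n) (v w : Fin n →₀ ℕ),
      v + w = u + Finsupp.single l 1 + Finsupp.single t 1 → w t = 0 → v ∈ U → w ∉ U)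
    {ω : Type u} [AddCommGroup ω] [Module R ω] (hω : IsCanonicalModule R ω) :
    Condition1 R ω := by
  obtain ⟨e⟩ := h.isCanonicalModule.nonempty_equiv hω
  refine le_trans ?_ (traceIdeal_le_of_equiv e)
  rw [h.maximalIdeal_eq, Ideal.span_le]
  rintro _ ⟨l, rfl⟩
  by_cases hl : Finsupp.single l 1 ∈ U
  · obtain ⟨u, hu, hd⟩ := hU l hl
    exact h.X_mem_traceIdeal hu hd
  · have : π (X l) = 0 := (h.monomial_eq_zero_iff _).mpr hl
    simp [this]

/-- The combinatorial consequence of the third condition for ideals generated by monomials. -/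
theorem le_of_condition3 (h : IsMonomialQuotient π U) {P : Set (PrimeSpectrum R)}
    (hP : AdmissiblePrimes P) (h3 : Condition3 P) {u v : Fin n →₀ ℕ} {l : Fin n}
    (huv : ∀ w, w + u ∈ U → w + v ∈ U) (hu : u + Finsupp.single l 1 ∈ U) :
    v ≤ u + Finsupp.single l 1 := by
  -- The hypothesis `huv` says that every monomial killing `x^v` kills `x^u`. Then `x^u x_l`, which
  -- is nonzero, must be a multiple of `x^v`.
  have hr : π (monomial u 1) ∈ (⊥ : Ideal R).colon
      (((⊥ : Ideal R).colon ((Ideal.span {π (monomial v 1)} : Ideal R) : Set R) : Ideal R) :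
        Set R) := by
    rw [Submodule.mem_colon]
    intro r hr
    obtain ⟨p, rfl⟩ := h.surjective r
    have h1 := Submodule.mem_colon.mp hr _ (Ideal.mem_span_singleton_self _)
    rw [smul_eq_mul, Ideal.mem_bot, ← map_mul, h.eq_zero_iff] at h1 ⊢
    intro z hz
    rw [mul_comm, coeff_mul_monomial']
    split_ifs with hle
    · have h2 := h1 (z - u + v) (huv _ (by rwa [tsub_add_cancel_of_le hle]))
      rwa [coeff_mul_monomial] at h2
    · rfl
  have hX : π (X l) ∈ maximalIdeal R := by
    rw [h.maximalIdeal_eq]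
    exact Ideal.subset_span ⟨l, rfl⟩
  have hmem := h3.mul_mem h.isNilpotent_maximalIdeal hP hr hX
  obtain ⟨c, hc⟩ := Ideal.mem_span_singleton'.mp hmem
  obtain ⟨p, rfl⟩ := h.surjective c
  rw [← map_mul, ← map_mul, ← sub_eq_zero, ← map_sub, h.eq_zero_iff] at hc
  have := hc _ hu
  by_contra hne
  rw [coeff_sub, coeff_mul_monomial', if_neg hne, X, monomial_mul] at this
  simp at this

end IsMonomialQuotient

end MonomialQuotient

/-! ### Intersections of irreducible monomial ideals and their standard monomials -/

/-- The exponents which are bounded by some `α i`. -/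
def stdMonomials {n : ℕ} (α : Fin 3 → Fin n → ℕ) : Set (Fin n →₀ ℕ) :=
  {u | ∃ i, ∀ l, u l ≤ α i l}

theorem isLowerSet_stdMonomials {n : ℕ} (α : Fin 3 → Fin n → ℕ) :
    IsLowerSet (stdMonomials α) := by
  rintro u v huv ⟨i, hi⟩
  exact ⟨i, fun l => (huv l).trans (hi l)⟩

theorem zero_mem_stdMonomials {n : ℕ} (α : Fin 3 → Fin n → ℕ) : 0 ∈ stdMonomials α :=
  ⟨0, fun l => by simp⟩

theorem exists_notMem_stdMonomials {n : ℕ} (α : Fin 3 → Fin n → ℕ) (l : Fin n) :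
    ∃ N, Finsupp.single l N ∉ stdMonomials α := by
  refine ⟨∑ i, α i l + 1, ?_⟩
  rintro ⟨i, hi⟩
  have h1 := hi l
  have h2 : α i l ≤ ∑ i, α i l :=
    Finset.single_le_sum (f := fun i => α i l) (fun _ _ => Nat.zero_le _) (Finset.mem_univ i)
  rw [Finsupp.single_eq_same] at h1
  omega

section Ideals

variable {k : Type u} [Field k] {n : ℕ}

theorem powerIdeal_eq_span_monomial (b : Fin n → ℕ+) :
    powerIdeal k b = Ideal.span ((fun s => (monomial s) (1 : k)) ''
      Set.range fun l => Finsupp.single l (b l : ℕ)) := by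
  rw [powerIdeal, ← Set.range_comp]
  congr 2
  ext1 l
  exact X_pow_eq_monomial

theorem mem_powerIdeal_iff (b : Fin n → ℕ+) (p : MvPolynomial (Fin n) k) :
    p ∈ powerIdeal k b ↔ ∀ u : Fin n →₀ ℕ, (∀ l, u l < b l) → coeff u p = 0 := by
  rw [powerIdeal_eq_span_monomial, mem_ideal_span_monomial_image]
  refine forall_congr' fun u => ?_
  simp only [mem_support_iff, Set.exists_range_iff, Finsupp.single_le_iff]
  rw [ne_eq, not_imp_comm]
  simp only [not_exists, not_le]

theorem mem_tripleIdeal_iff (a : Fin 3 → Fin n → ℕ+) (p : MvPolynomial (Fin n) k) :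
    p ∈ tripleIdeal k a ↔ ∀ u ∈ stdMonomials (fun i l => (a i l : ℕ) - 1), coeff u p = 0 := by
  rw [tripleIdeal, Ideal.mem_inf, Ideal.mem_inf]
  simp only [mem_powerIdeal_iff]
  have key : ∀ i l (u : Fin n →₀ ℕ), u l ≤ (a i l : ℕ) - 1 ↔ u l < a i l := fun i l u => by
    have := (a i l).pos
    omega
  simp only [stdMonomials, Set.mem_ofPred_eq, key]
  constructor
  · rintro ⟨⟨h0, h1⟩, h2⟩ u ⟨i, hi⟩
    fin_cases i
    exacts [h0 u hi, h1 u hi, h2 u hi]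
  · exact fun h => ⟨⟨fun u hu => h u ⟨0, hu⟩, fun u hu => h u ⟨1, hu⟩⟩, fun u hu => h u ⟨2, hu⟩⟩

/-- The exponents of the standard monomials of a Teter ideal. -/
def teterMonomials (a : Fin n → ℕ) : Set (Fin n →₀ ℕ) :=
  {u | (∀ l, u l < a l) ∧ ∃ l, u l + 1 ≠ a l}

theorem mem_teterIdeal_iff (a : Fin n → ℕ+) (p : MvPolynomial (Fin n) k) :
    p ∈ powerIdeal k a ⊔ Ideal.span {∏ i, MvPolynomial.X i ^ ((a i : ℕ) - 1)} ↔
      ∀ u ∈ teterMonomials fun l => (a l : ℕ), coeff u p = 0 := by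
  have hprod : (∏ i, X i ^ ((a i : ℕ) - 1) : MvPolynomial (Fin n) k) =
      monomial (Finsupp.equivFunOnFinite.symm fun l => (a l : ℕ) - 1) 1 := by
    rw [monomial_eq, Finsupp.prod_fintype _ _ (by simp)]
    simp
  rw [powerIdeal_eq_span_monomial, hprod, ← Ideal.span_union,
    ← Set.image_singleton (f := fun s => (monomial s) (1 : k)), ← Set.image_union,
    mem_ideal_span_monomial_image]
  refine forall_congr' fun u => ?_
  rw [mem_support_iff, ne_eq, not_imp_comm]
  refine imp_congr_left ?_
  rw [not_iff_comm]
  simp only [Set.mem_union, Set.mem_singleton_iff, or_and_right, exists_or, Set.exists_range_iff,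
    Finsupp.single_le_iff, exists_eq_left, teterMonomials, Set.mem_ofPred_eq, not_and_or, not_forall,
    not_lt, not_exists, not_not]
  constructor
  · rintro (h | h)
    · exact Or.inl h
    · refine Or.inr fun l => ?_
      have h1 := h l
      change (a l : ℕ) - 1 ≤ u l
      omega
  · rintro (h | h)
    · exact Or.inl h
    · by_cases h' : ∃ l, (a l : ℕ) ≤ u l
      · exact Or.inl h'
      · push Not at h'
        refine Or.inr fun l => ?_
        have h1 : (a l : ℕ) - 1 ≤ u l := h l
        have h2 := h' l
        omega

theorem isMonomialQuotient_mk (a : Fin 3 → Fin n → ℕ+) :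
    IsMonomialQuotient (Ideal.Quotient.mkₐ k (tripleIdeal k a))
      (stdMonomials fun i l => (a i l : ℕ) - 1) where
  surjective := Ideal.Quotient.mkₐ_surjective k _
  eq_zero_iff p := by
    rw [Ideal.Quotient.mkₐ_eq_mk, Ideal.Quotient.eq_zero_iff_mem, mem_tripleIdeal_iff]
  lower := isLowerSet_stdMonomials _
  zero_mem := zero_mem_stdMonomials _
  exists_notMem := exists_notMem_stdMonomials _

/-- The trace ideal does not see the `k`-algebra structure, so one can be transported along `e`;
this is why a mere ring isomorphism suffices. -/
theorem condition1_of_ringEquiv {I : Ideal (MvPolynomial (Fin n) k)} {U : Set (Fin n →₀ ℕ)}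
    (hI : ∀ p, p ∈ I ↔ ∀ u ∈ U, coeff u p = 0) (hlow : IsLowerSet U)
    (hfin : ∀ l, ∃ N, Finsupp.single l N ∉ U)
    (hU : ∀ l, Finsupp.single l 1 ∈ U → ∃ u ∈ U, ∀ (t : Fin n) (v w : Fin n →₀ ℕ),
      v + w = u + Finsupp.single l 1 + Finsupp.single t 1 → w t = 0 → v ∈ U → w ∉ U)
    {R : Type u} [CommRing R] [IsLocalRing R] (e : R ≃+* (MvPolynomial (Fin n) k ⧸ I))
    {ω : Type u} [AddCommGroup ω] [Module R ω] (hω : IsCanonicalModule R ω) :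
    Condition1 R ω := by
  let _ : Algebra k R :=
    ((e.symm : (MvPolynomial (Fin n) k ⧸ I) →+* R).comp (algebraMap k _)).toAlgebra
  let π : MvPolynomial (Fin n) k →ₐ[k] R :=
    { (e.symm : (MvPolynomial (Fin n) k ⧸ I) →+* R).comp (Ideal.Quotient.mk I) with
      commutes' := fun _ => rfl }
  have hπ : ∀ p, π p = e.symm (Ideal.Quotient.mk I p) := fun _ => rfl
  have hzero : ∀ p, π p = 0 ↔ ∀ u ∈ U, coeff u p = 0 := fun p => by
    rw [hπ, map_eq_zero_iff _ e.symm.injective, Ideal.Quotient.eq_zero_iff_mem, hI]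
  have h : IsMonomialQuotient π U :=
    { surjective := e.symm.surjective.comp Ideal.Quotient.mk_surjective
      eq_zero_iff := hzero
      lower := hlow
      zero_mem := by
        by_contra h0
        have : π 1 = 0 := (hzero 1).mpr fun u hu => absurd (hlow (zero_le : 0 ≤ u) hu) h0
        rw [map_one] at this
        exact one_ne_zero this
      exists_notMem := hfin }
  exact h.condition1 hU hω

/-- Adding variables which belong to the ideal and reordering the variables does not change the
quotient. -/
theorem nonempty_algEquiv {m : ℕ} {I : Ideal (MvPolynomial (Fin n) k)}
    {J : Ideal (MvPolynomial (Fin m) k)} {U : Set (Fin n →₀ ℕ)} {V : Set (Fin m →₀ ℕ)}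
    (hI : ∀ p, p ∈ I ↔ ∀ u ∈ U, coeff u p = 0) (hJ : ∀ p, p ∈ J ↔ ∀ u ∈ V, coeff u p = 0)
    {φ : Fin m → Fin n} (hφ : Function.Injective φ)
    (hUV : ∀ u, u ∈ U ↔ ∃ v ∈ V, Finsupp.mapDomain φ v = u) :
    Nonempty ((MvPolynomial (Fin n) k ⧸ I) ≃ₐ[k] (MvPolynomial (Fin m) k ⧸ J)) := by
  classical
  let f : MvPolynomial (Fin m) k →ₐ[k] (MvPolynomial (Fin n) k ⧸ I) :=
    (Ideal.Quotient.mkₐ k I).comp (rename φ)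
  have hker : J = RingHom.ker f := by
    ext p
    rw [RingHom.mem_ker, AlgHom.comp_apply, Ideal.Quotient.mkₐ_eq_mk,
      Ideal.Quotient.eq_zero_iff_mem, hI, hJ]
    constructor
    · intro h u hu
      obtain ⟨v, hv, rfl⟩ := (hUV u).mp hu
      rw [coeff_rename_mapDomain φ hφ, h v hv]
    · intro h v hv
      rw [← coeff_rename_mapDomain φ hφ]
      exact h _ ((hUV _).mpr ⟨v, hv, rfl⟩)
  have hsurj : Function.Surjective f := by
    have hX : ∀ l, ∃ q, f q = Ideal.Quotient.mk I (X l) := by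
      intro l
      by_cases hl : l ∈ Set.range φ
      · obtain ⟨j, rfl⟩ := hl
        exact ⟨X j, by simp [f]⟩
      · refine ⟨0, ?_⟩
        rw [map_zero, eq_comm, Ideal.Quotient.eq_zero_iff_mem, hI]
        intro u hu
        obtain ⟨v, -, rfl⟩ := (hUV u).mp hu
        rw [coeff_X, if_neg]
        intro h
        have h1 := DFunLike.congr_fun h l
        rw [Finsupp.single_eq_same, Finsupp.mapDomain_of_notMem_range _ _ hl] at h1
        exact one_ne_zero h1
    intro x
    obtain ⟨p, rfl⟩ := Ideal.Quotient.mk_surjective x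
    induction p using MvPolynomial.induction_on with
    | C c => exact ⟨C c, f.commutes c⟩
    | add p q hp hq =>
      obtain ⟨p', hp'⟩ := hp
      obtain ⟨q', hq'⟩ := hq
      exact ⟨p' + q', by rw [map_add, map_add, hp', hq']⟩
    | mul_X p l hp =>
      obtain ⟨p', hp'⟩ := hp
      obtain ⟨q', hq'⟩ := hX l
      exact ⟨p' * q', by rw [map_mul, map_mul, hp', hq']⟩
  exact ⟨((Ideal.quotientEquivAlgOfEq k hker).trans
    (Ideal.quotientKerAlgEquivOfSurjective hsurj)).symm⟩

theorem mem_stdMonomials_iff_exists_mapDomain {m : ℕ} {α : Fin 3 → Fin n → ℕ} {φ : Fin m → Fin n}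
    (hφ : Function.Injective φ) (hα : ∀ i, ∀ l ∉ Set.range φ, α i l = 0) (u : Fin n →₀ ℕ) :
    u ∈ stdMonomials α ↔
      ∃ v ∈ stdMonomials (fun i l => α i (φ l)), Finsupp.mapDomain φ v = u := by
  constructor
  · rintro ⟨i, hi⟩
    refine ⟨u.comapDomain φ hφ.injOn, ⟨i, fun l => by simpa using hi (φ l)⟩, ?_⟩
    refine Finsupp.mapDomain_comapDomain φ hφ u fun l hl => ?_
    by_contra hl'
    have h1 := hi l
    rw [hα i l hl'] at h1
    simp only [Finset.mem_coe, Finsupp.mem_support_iff] at hl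
    omega
  · rintro ⟨v, ⟨i, hi⟩, rfl⟩
    refine ⟨i, fun l => ?_⟩
    by_cases hl : l ∈ Set.range φ
    · obtain ⟨j, rfl⟩ := hl
      rw [Finsupp.mapDomain_apply hφ]
      exact hi j
    · rw [Finsupp.mapDomain_of_notMem_range _ _ hl]
      exact Nat.zero_le _

end Ideals

/-! ### The type -/

section CMType

open IsLocalRing

variable {k R : Type u} [Field k] [CommRing R] [Algebra k R] [IsLocalRing R] {n : ℕ}
  {π : MvPolynomial (Fin n) k →ₐ[k] R}

/-- The type is at most the number of maximal standard monomials. -/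
theorem IsMonomialQuotient.cmType_le_card {U : Set (Fin n →₀ ℕ)} (h : IsMonomialQuotient π U)
    (B : Finset (Fin n →₀ ℕ))
    (hB : ∀ u, u ∈ B ↔ u ∈ U ∧ ∀ t, u + Finsupp.single t 1 ∉ U) : cmType R ≤ B.card := by
  classical
  have hsoc : ∀ u ∈ B, π (monomial u 1) ∈
      Submodule.torsionBySet R R (maximalIdeal R : Set R) := by
    intro u hu
    rw [Submodule.mem_torsionBySet_iff]
    rintro ⟨r, hr⟩
    have hle : maximalIdeal R ≤ (Ideal.span {π (monomial u 1)}).annihilator := by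
      rw [h.maximalIdeal_eq, Ideal.span_le]
      rintro _ ⟨t, rfl⟩
      rw [SetLike.mem_coe, Submodule.mem_annihilator_span_singleton, smul_eq_mul, ← map_mul,
        mul_comm, X, monomial_mul, one_mul]
      exact (h.monomial_eq_zero_iff _).mpr (((hB u).mp hu).2 t)
    exact Submodule.mem_annihilator_span_singleton _ _ |>.mp (hle hr)
  let v : B → Submodule.torsionBySet R R (maximalIdeal R : Set R) := fun u => ⟨_, hsoc u u.2⟩
  have hspan : Submodule.span (R ⧸ maximalIdeal R) (Set.range v) = ⊤ := by
    rw [eq_top_iff]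
    rintro ⟨x, hx⟩ -
    obtain ⟨p, rfl⟩ := h.surjective x
    -- If `w` is standard but not maximal, some `x_t x^w` is nonzero; as `x_t` kills a socle
    -- element, its coefficient at `w` vanishes.
    have hp : π p = ∑ u : B, algebraMap k R (coeff (u : Fin n →₀ ℕ) p) * π (monomial u 1) := by
      have : π (p - ∑ u : B, coeff (u : Fin n →₀ ℕ) p • monomial (u : Fin n →₀ ℕ) (1 : k)) = 0 := by
        rw [h.eq_zero_iff]
        intro w hw
        have hsum : coeff w (∑ u : B, coeff (u : Fin n →₀ ℕ) p • monomial (u : Fin n →₀ ℕ) (1 : k))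
            = if w ∈ B then coeff w p else 0 := by
          rw [coeff_sum, Finset.sum_coe_sort B fun u => coeff w (coeff u p • monomial u (1 : k))]
          simp [coeff_monomial]
        rw [coeff_sub, hsum]
        split_ifs with hwB
        · exact sub_self _
        · rw [hB] at hwB
          push Not at hwB
          obtain ⟨t, ht⟩ := hwB hw
          have h1 := (Submodule.mem_torsionBySet_iff _ _).mp hx ⟨π (X t), by
            rw [h.maximalIdeal_eq]; exact Ideal.subset_span ⟨t, rfl⟩⟩
          rw [smul_eq_mul, ← map_mul, h.eq_zero_iff] at h1
          have h2 := h1 _ ht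
          rwa [mul_comm, coeff_mul_X, ← sub_zero (coeff w p)] at h2
      rw [map_sub, sub_eq_zero] at this
      rw [this, map_sum]
      refine Finset.sum_congr rfl fun u _ => ?_
      rw [map_smul, Algebra.smul_def]
    have hx' : (⟨π p, hx⟩ : Submodule.torsionBySet R R (maximalIdeal R : Set R)) =
        ∑ u : B, Ideal.Quotient.mk (maximalIdeal R) (algebraMap k R (coeff (u : Fin n →₀ ℕ) p)) •
          v u := by
      refine Subtype.ext ?_
      refine hp.trans ?_
      simp only [AddSubmonoidClass.coe_finsetSum]
      rfl
    rw [hx']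
    exact Submodule.sum_mem _ fun u _ => Submodule.smul_mem _ _ (Submodule.subset_span ⟨u, rfl⟩)
  calc cmType R ≤ Fintype.card B := finrank_le_of_span_eq_top hspan
    _ = B.card := Fintype.card_coe B

/-- If the type is three, then the three irreducible components are irredundant. -/
theorem IsMonomialQuotient.antichain_of_cmType {α : Fin 3 → Fin n → ℕ}
    (h : IsMonomialQuotient π (stdMonomials α)) (htype : cmType R = 3) {i j : Fin 3} (hij : i ≠ j) :
    ¬ α i ≤ α j := by
  classical
  intro hle
  let A : Fin 3 → (Fin n →₀ ℕ) := fun i => Finsupp.equivFunOnFinite.symm (α i)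
  -- A maximal standard exponent is one of the rows, and row `i` is redundant because row `j` lies
  -- above it. Hence there are at most two, against type three.
  have hmax : ∀ u ∈ stdMonomials α, (∀ t, u + Finsupp.single t 1 ∉ stdMonomials α) →
      u ∈ (Finset.univ.erase i).image A := by
    rintro u ⟨q, hq⟩ hu
    obtain ⟨q, hqi, hq⟩ : ∃ q, q ≠ i ∧ ∀ l, u l ≤ α q l := by
      by_cases hqi : q = i
      · subst hqi
        exact ⟨j, hij.symm, fun l => (hq l).trans (hle l)⟩
      · exact ⟨q, hqi, hq⟩
    refine Finset.mem_image.mpr ⟨q, by simp [hqi], ?_⟩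
    ext t
    by_contra hne
    refine hu t ⟨q, fun l => ?_⟩
    have h1 := hq l
    rw [Finsupp.add_apply]
    by_cases hl : l = t
    · subst hl
      have : α q l ≠ u l := hne
      rw [Finsupp.single_eq_same]
      omega
    · rw [Finsupp.single_eq_of_ne hl]
      exact h1
  let B := ((Finset.univ.erase i).image A).filter fun u =>
    u ∈ stdMonomials α ∧ ∀ t, u + Finsupp.single t 1 ∉ stdMonomials α
  have h1 : cmType R ≤ B.card := h.cmType_le_card B fun u => by
    simp only [B, Finset.mem_filter]
    exact ⟨fun hu => hu.2, fun hu => ⟨hmax u hu.1 hu.2, hu⟩⟩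
  have h2 : B.card ≤ 2 := by
    calc B.card ≤ ((Finset.univ.erase i).image A).card := Finset.card_filter_le _ _
      _ ≤ (Finset.univ.erase i).card := Finset.card_image_le
      _ = 2 := by simp
  omega

end CMType

/-! ### Combinatorics of three exponent vectors -/

section Combinatorics

variable {n : ℕ} {α : Fin 3 → Fin n → ℕ}

/-- The three components can be enumerated as `i`, `j`, `q`. -/
def Enumerates (i j q : Fin 3) : Prop :=
  i ≠ j ∧ i ≠ q ∧ j ≠ q ∧ ∀ x, x = i ∨ x = j ∨ x = q

theorem exists_enumerates {i j : Fin 3} (h : i ≠ j) : ∃ q, Enumerates i j q := by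
  unfold Enumerates
  decide +revert

theorem Enumerates.swap {i j q : Fin 3} (h : Enumerates i j q) : Enumerates i q j := by
  unfold Enumerates at *
  grind

/-- Row `j` is obtained from row `i` by increasing entry `l` by one and decreasing other entries. -/
def Bump (α : Fin 3 → Fin n → ℕ) (l : Fin n) (j i : Fin 3) : Prop :=
  α j l = α i l + 1 ∧ ∀ s, s ≠ l → α j s ≤ α i s

/-- In every coordinate some row is such that all other rows which are positive there are bumps. -/
def HasHubs (α : Fin 3 → Fin n → ℕ) : Prop :=
  ∀ l, ∃ i, ∀ j, j ≠ i → 1 ≤ α j l → Bump α l j i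

theorem bump_of_le (hanti : ∀ i j, i ≠ j → ¬ α i ≤ α j) {i j : Fin 3} (hij : j ≠ i) {l : Fin n}
    (h : α j ≤ α i + Pi.single l 1) : Bump α l j i := by
  have h1 : ∀ s, s ≠ l → α j s ≤ α i s := fun s hs => by
    simpa [Pi.single_eq_of_ne hs] using h s
  refine ⟨?_, h1⟩
  have h2 : α j l ≤ α i l + 1 := by simpa using h l
  by_contra hne
  refine hanti j i hij fun s => ?_
  change α j s ≤ α i s
  by_cases hs : s = l
  · subst hs; omega
  · exact h1 s hs

/-- A row positive at `l` that is not below another row plus `e_l` is a hub by `hM`. If there is no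
such row, every row positive at `l` is itself a bump of another row, and following these bumps leads
to a hub. -/
theorem hasHubs_of_forall (hanti : ∀ i j, i ≠ j → ¬ α i ≤ α j)
    (hM : ∀ (u v : Fin n → ℕ) (l : Fin n), (∀ i, u ≤ α i → ∃ q, α i + v ≤ α q + u) →
      (∃ i, u + Pi.single l 1 ≤ α i) → v ≤ u + Pi.single l 1) : HasHubs α := by
  intro l
  have single_le : ∀ i, 1 ≤ α i l → Pi.single l 1 ≤ α i := fun i hi => by
    intro s
    by_cases hs : s = l
    · subst hs; simpa using hi
    · simp [Pi.single_eq_of_ne hs]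
  have private_hub : ∀ i, 1 ≤ α i l → (∀ j, j ≠ i → ¬ α i ≤ α j + Pi.single l 1) →
      ∀ j, j ≠ i → 1 ≤ α j l → Bump α l j i := by
    intro i hi hij q hq hql
    refine bump_of_le hanti hq ?_
    have e1 := tsub_add_cancel_of_le (single_le i hi)
    have e2 := tsub_add_cancel_of_le (single_le q hql)
    -- Only row `i` lies above `α i - e_l`, and `α i + (α q - e_l) = α q + (α i - e_l)`.
    have := hM (α i - Pi.single l 1) (α q - Pi.single l 1) l ?_ ⟨i, e1.le⟩
    · rw [e1] at this
      exact tsub_le_iff_right.mp this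
    · intro i' hi'
      have : i' = i := by
        by_contra hne
        exact hij i' hne (tsub_le_iff_right.mp hi')
      subst this
      refine ⟨q, fun s => ?_⟩
      have h1 := congrFun e1 s
      have h2 := congrFun e2 s
      simp only [Pi.add_apply, Pi.sub_apply] at h1 h2 ⊢
      omega
  by_cases hex : ∃ i, 1 ≤ α i l ∧ ∀ j, j ≠ i → ¬ α i ≤ α j + Pi.single l 1
  · obtain ⟨i, hi, hij⟩ := hex
    exact ⟨i, private_hub i hi hij⟩
  push Not at hex
  by_cases hT : ∃ i, 1 ≤ α i l
  -- For a smallest positive entry at `l`, the row that it bumps must be zero there.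
  · obtain ⟨i, hi, hmin⟩ : ∃ i, 1 ≤ α i l ∧ ∀ j, 1 ≤ α j l → α i l ≤ α j l := by
      obtain ⟨i, hi, h⟩ := Finset.exists_min_image (Finset.univ.filter fun i => 1 ≤ α i l)
        (fun i => α i l) (by obtain ⟨i, hi⟩ := hT; exact ⟨i, by simpa using hi⟩)
      exact ⟨i, by simpa using hi, fun j hj => h j (by simpa using hj)⟩
    obtain ⟨j, hji, hj⟩ := hex i hi
    have hb := bump_of_le hanti hji.symm hj
    have hj0 : α j l = 0 := by
      by_contra h0
      have := hmin j (Nat.one_le_iff_ne_zero.mpr h0)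
      have := hb.1
      omega
    obtain ⟨q, hijq⟩ := exists_enumerates hji.symm
    by_cases hq : 1 ≤ α q l
    · obtain ⟨x, hx, hqx⟩ := hex q hq
      have hbx := bump_of_le hanti hx.symm hqx
      unfold Enumerates at hijq
      rcases hijq.2.2.2 x with rfl | rfl | rfl
      · refine ⟨x, fun y hy hyl => ?_⟩
        rcases hijq.2.2.2 y with rfl | rfl | rfl
        · exact absurd rfl hy
        · omega
        · exact hbx
      · refine ⟨x, fun y hy hyl => ?_⟩
        rcases hijq.2.2.2 y with rfl | rfl | rfl
        · exact hb
        · exact absurd rfl hy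
        · exact hbx
      · exact absurd rfl hx
    · refine ⟨j, fun y hy hyl => ?_⟩
      rcases hijq.2.2.2 y with rfl | rfl | rfl
      · exact hb
      · exact absurd rfl hy
      · exact absurd hyl hq
  · push Not at hT
    exact ⟨0, fun j _ hj => absurd (hT j) (by omega)⟩

/-- Since row `q` is not below row `j`, it exceeds it at some `s ≠ l`. There neither `i` nor `q` can
be the hub, so `j` is; symmetrically `q` is the hub at some `t`. Elsewhere the three rows agree, and
a common positive value would contradict the jump by one at a hub. -/
theorem teter_shape (hanti : ∀ i j, i ≠ j → ¬ α i ≤ α j) (hC : HasHubs α) {i j q : Fin 3}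
    (hijq : Enumerates i j q) {l : Fin n} (hj : Bump α l j i) (hq : Bump α l q i) :
    ∃ s t, s ≠ l ∧ t ≠ l ∧ s ≠ t ∧ (α i s = α j s + 1 ∧ α q s = α j s + 1) ∧
      (α i t = α q t + 1 ∧ α j t = α q t + 1) ∧ ∀ r, r ≠ l → r ≠ s → r ≠ t → ∀ x, α x r = 0 := by
  have key : ∀ {i j q : Fin 3}, Enumerates i j q → Bump α l j i → Bump α l q i →
      ∃ s, s ≠ l ∧ Bump α s i j ∧ Bump α s q j := by
    intro i j q hijq hj hq
    obtain ⟨hij, hiq, hjq, hall⟩ := hijq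
    have := hanti q j hjq.symm
    rw [Pi.le_def] at this
    push Not at this
    obtain ⟨s, hs⟩ := this
    have hsl : s ≠ l := by
      rintro rfl
      have := hj.1
      have := hq.1
      omega
    have hsi := hq.2 s hsl
    obtain ⟨h, hh⟩ := hC s
    rcases hall h with rfl | rfl | rfl
    · have := (hh q hiq.symm (by omega)).1
      omega
    · exact ⟨s, hsl, hh _ hij (by omega), hh _ hjq.symm (by omega)⟩
    · exfalso
      have hi := hh i hiq (by omega)
      refine hanti j h hjq fun r => ?_
      change α j r ≤ α h r
      by_cases hrl : r = l
      · subst hrl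
        have := hj.1
        have := hq.1
        omega
      · by_cases hrs : r = s
        · subst hrs; omega
        · exact (hj.2 r hrl).trans (hi.2 r hrs)
  obtain ⟨s, hsl, hs1, hs2⟩ := key hijq hj hq
  obtain ⟨t, htl, ht1, ht2⟩ := key hijq.swap hq hj
  obtain ⟨hij, hiq, hjq, hall⟩ := hijq
  have hst : s ≠ t := by
    rintro rfl
    have := hs2.1
    have := ht2.1
    omega
  refine ⟨s, t, hsl, htl, hst, ⟨hs1.1, hs2.1⟩, ⟨ht1.1, ht2.1⟩, fun r hrl hrs hrt => ?_⟩
  have e1 := hj.2 r hrl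
  have e2 := hq.2 r hrl
  have e3 := hs1.2 r hrs
  have e4 := hs2.2 r hrs
  have e5 := ht1.2 r hrt
  have e6 := ht2.2 r hrt
  by_contra hne
  push Not at hne
  obtain ⟨x, hx⟩ := hne
  obtain ⟨h, hh⟩ := hC r
  have hxi : α x r = α i r := by
    rcases hall x with rfl | rfl | rfl <;> omega
  rcases hall h with rfl | rfl | rfl
  · have := (hh j hij.symm (by omega)).1
    omega
  · have := (hh i hij (by omega)).1
    omega
  · have := (hh i hiq (by omega)).1
    omega

/-- The possible shapes of the exponents of three irredundant irreducible monomial ideals. -/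
theorem exists_shape (hanti : ∀ i j, i ≠ j → ¬ α i ≤ α j) (hC : HasHubs α)
    (hex : ∀ i j q l t, Enumerates i j q → Bump α l j i → Bump α t q i → l ≠ t →
      1 ≤ α i l → 1 ≤ α i t → (∀ s, s ≠ l → α j s = 0) → (∀ s, s ≠ t → α q s = 0) →
      ∃ s, s ≠ l ∧ s ≠ t ∧ 1 ≤ α i s) :
    (∀ l x y, x ≠ y → α x l = 0 ∨ α y l = 0) ∨
    ∃ i j q, Enumerates i j q ∧ ∃ l, α j l = α i l + 1 ∧
      ((α q l = α i l + 1 ∧ ∃ s t, s ≠ l ∧ t ≠ l ∧ s ≠ t ∧ (α i s = α j s + 1 ∧ α q s = α j s + 1) ∧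
        (α i t = α q t + 1 ∧ α j t = α q t + 1) ∧
          ∀ r, r ≠ l → r ≠ s → r ≠ t → ∀ x, α x r = 0) ∨
      (∃ t, t ≠ l ∧ α i t = α j t + 1 ∧ α q l = 0 ∧ α q t = 0 ∧
        ∀ s, s ≠ l → s ≠ t → α i s = 0 ∧ α j s = 0) ∨
      (∃ t, t ≠ l ∧ α q t = α i t + 1 ∧ (∀ s, s ≠ l → α j s = 0) ∧ (∀ s, s ≠ t → α q s = 0) ∧
        ∃ s, s ≠ l ∧ s ≠ t ∧ 1 ≤ α i s) ∨
      ((∀ s, s ≠ l → α j s = 0) ∧ α q l = 0 ∧ ∀ s, s ≠ l → α i s = 0 ∨ α q s = 0)) := by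
  by_cases hD : ∀ l x y, x ≠ y → α x l = 0 ∨ α y l = 0
  · exact Or.inl hD
  right
  by_cases hZ : ∃ i j q l, Enumerates i j q ∧ Bump α l j i ∧ Bump α l q i
  · obtain ⟨i, j, q, l, hijq, hj, hq⟩ := hZ
    exact ⟨i, j, q, hijq, l, hj.1, Or.inl ⟨hq.1, teter_shape hanti hC hijq hj hq⟩⟩
  -- As no hub now has two bumps, a coordinate shared by two rows is zero in the third.
  have shared : ∀ l x y, x ≠ y → 1 ≤ α x l → 1 ≤ α y l → ∃ i j q, Enumerates i j q ∧
      (i = x ∧ j = y ∨ i = y ∧ j = x) ∧ Bump α l j i ∧ α q l = 0 := by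
    intro l x y hxy hx hy
    obtain ⟨i, hi⟩ := hC l
    have main : ∀ x y, x ≠ y → 1 ≤ α x l → 1 ≤ α y l → x ≠ i → ∃ q, Enumerates i x q ∧
        i = y ∧ Bump α l x i ∧ α q l = 0 := by
      intro x y hxy hx hy hxi
      obtain ⟨q, hq⟩ := exists_enumerates hxi.symm
      have hq0 : α q l = 0 := by
        by_contra h0
        exact hZ ⟨i, x, q, l, hq, hi x hxi hx,
          hi q hq.2.1.symm (Nat.one_le_iff_ne_zero.mpr h0)⟩
      refine ⟨q, hq, ?_, hi x hxi hx, hq0⟩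
      rcases hq.2.2.2 y with h | rfl | rfl
      · exact h.symm
      · exact absurd rfl hxy
      · omega
    by_cases hxi : x = i
    · obtain ⟨q, h1, h2, h3, h4⟩ := main y x hxy.symm hy hx (fun h => hxy (hxi.trans h.symm))
      exact ⟨i, y, q, h1, Or.inl ⟨h2, rfl⟩, h3, h4⟩
    · obtain ⟨q, h1, h2, h3, h4⟩ := main x y hxy hx hy hxi
      exact ⟨i, x, q, h1, Or.inr ⟨h2, rfl⟩, h3, h4⟩
  push Not at hD
  obtain ⟨l, x, y, hxy, hx, hy⟩ := hD
  obtain ⟨i, j, q, hijq, hijxy, hb, hq⟩ :=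
    shared l x y hxy (Nat.one_le_iff_ne_zero.mpr hx) (Nat.one_le_iff_ne_zero.mpr hy)
  have hil : 1 ≤ α i l := by
    rcases hijxy with ⟨rfl, rfl⟩ | ⟨rfl, rfl⟩ <;> omega
  clear hx hy hijxy hxy x y
  refine ⟨i, j, q, hijq, l, hb.1, Or.inr ?_⟩
  have hijq' := hijq
  obtain ⟨hij, hiq, hjq, hall⟩ := hijq'
  -- A second coordinate shared by `i` and `j` has the opposite orientation, since `j` is at most
  -- `i` away from `l`: the square shape. Otherwise `i` and `q` may share a coordinate (corner) or
  -- not (hook).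
  by_cases hB : ∃ t, t ≠ l ∧ 1 ≤ α j t
  · obtain ⟨t, htl, hjt⟩ := hB
    have hit : 1 ≤ α i t := hjt.trans (hb.2 t htl)
    have orient : ∀ s, s ≠ l → 1 ≤ α i s → 1 ≤ α j s → Bump α s i j ∧ α q s = 0 := by
      intro s hsl his hjs
      obtain ⟨i', j', q', h', hor, hb', hq'⟩ := shared s i j hij his hjs
      rcases hor with ⟨rfl, rfl⟩ | ⟨rfl, rfl⟩
      · have := hb'.1
        have := hb.2 s hsl
        omega
      · refine ⟨hb', ?_⟩
        rcases hall q' with h | h | h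
        · exact absurd h.symm h'.2.2.1
        · exact absurd h.symm h'.2.1
        · exact h ▸ hq'
    obtain ⟨hbt, hqt⟩ := orient t htl hit hjt
    refine Or.inl ⟨t, htl, hbt.1, hq, hqt, fun s hsl hst => ?_⟩
    have h1 := hb.2 s hsl
    have h2 := hbt.2 s hst
    by_contra hne
    have := (orient s hsl (by omega) (by omega)).1.1
    omega
  push Not at hB
  have hj0 : ∀ s, s ≠ l → α j s = 0 := fun s hs => by have := hB s hs; omega
  right
  by_cases hA : ∃ t, t ≠ l ∧ 1 ≤ α i t ∧ 1 ≤ α q t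
  · obtain ⟨t, htl, hit, hqt⟩ := hA
    have orient : ∀ s, s ≠ l → 1 ≤ α i s → 1 ≤ α q s → Bump α s q i := by
      intro s hsl his hqs
      obtain ⟨i', j', q', h', hor, hb', hq'⟩ := shared s i q hiq his hqs
      rcases hor with ⟨rfl, rfl⟩ | ⟨rfl, rfl⟩
      · exact hb'
      · have := hb'.2 l hsl.symm
        omega
    have hbt := orient t htl hit hqt
    have hq0 : ∀ s, s ≠ t → α q s = 0 := by
      intro s hst
      by_cases hsl : s = l
      · exact hsl ▸ hq
      · by_contra h0
        have h1 := hbt.2 s hst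
        have := (orient s hsl (by omega) (by omega)).1
        omega
    exact Or.inl ⟨t, htl, hbt.1, hj0, hq0,
      hex i j q l t hijq hb hbt htl.symm hil hit hj0 hq0⟩
  · push Not at hA
    refine Or.inr ⟨hj0, hq, fun s hsl => ?_⟩
    by_cases h0 : α i s = 0
    · exact Or.inl h0
    · have := hA s hsl (Nat.one_le_iff_ne_zero.mpr h0)
      right
      omega

end Combinatorics

/-! ### From the third condition to the classification -/

/-- Without a third variable in row `i`, the monomial `x_l^(α i l)` lies in `0 : (0 : x_t)`, while
its nonzero multiple by `x_l` is not divisible by `x_t`. -/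
theorem exists_pos_of_forall {n : ℕ} {α : Fin 3 → Fin n → ℕ}
    (hM : ∀ (u v : Fin n → ℕ) (l : Fin n), (∀ i, u ≤ α i → ∃ q, α i + v ≤ α q + u) →
      (∃ i, u + Pi.single l 1 ≤ α i) → v ≤ u + Pi.single l 1)
    (i j q : Fin 3) (l t : Fin n) (hijq : Enumerates i j q) (hj : Bump α l j i) (hq : Bump α t q i)
    (hlt : l ≠ t) (hil : 1 ≤ α i l) (hit : 1 ≤ α i t) (hj0 : ∀ s, s ≠ l → α j s = 0)
    (hq0 : ∀ s, s ≠ t → α q s = 0) : ∃ s, s ≠ l ∧ s ≠ t ∧ 1 ≤ α i s := by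
  by_contra hne
  push Not at hne
  obtain ⟨hij, hiq, hjq, hall⟩ := hijq
  have h1 := hj.1
  have h2 := hq.1
  have h3 := hq0 l hlt
  have h4 := hj0 t hlt.symm
  have := hM (Pi.single l (α i l)) (Pi.single t 1) l ?_ ⟨j, fun s => ?_⟩ t
  · rw [Pi.add_apply, Pi.single_eq_same, Pi.single_eq_of_ne hlt.symm,
      Pi.single_eq_of_ne hlt.symm] at this
    exact Nat.not_succ_le_zero 0 this
  · intro x hx
    rcases hall x with rfl | rfl | rfl
    · refine ⟨q, fun s => ?_⟩
      simp only [Pi.add_apply]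
      by_cases hsl : s = l
      · subst hsl
        rw [Pi.single_eq_same, Pi.single_eq_of_ne hlt]
        omega
      · by_cases hst : s = t
        · subst hst
          rw [Pi.single_eq_same, Pi.single_eq_of_ne hsl]
          omega
        · have := hne s hsl hst
          rw [Pi.single_eq_of_ne hsl, Pi.single_eq_of_ne hst]
          omega
    · refine ⟨i, fun s => ?_⟩
      simp only [Pi.add_apply]
      by_cases hsl : s = l
      · subst hsl
        rw [Pi.single_eq_same, Pi.single_eq_of_ne hlt]
        omega
      · rw [Pi.single_eq_of_ne hsl, hj0 s hsl]
        by_cases hst : s = t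
        · subst hst
          rw [Pi.single_eq_same]
          omega
        · rw [Pi.single_eq_of_ne hst]
          omega
    · have := hx l
      rw [Pi.single_eq_same] at this
      have h5 : α i l ≤ α x l := this
      omega
  · change (Pi.single l (α i l) + Pi.single l 1 : Fin n → ℕ) s ≤ α j s
    rw [Pi.add_apply]
    by_cases hsl : s = l
    · subst hsl
      rw [Pi.single_eq_same, Pi.single_eq_same]
      omega
    · rw [Pi.single_eq_of_ne hsl, Pi.single_eq_of_ne hsl]
      omega

theorem IsMonomialQuotient.le_of_condition3_stdMonomials {k R : Type u} [Field k] [CommRing R]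
    [Algebra k R] [IsLocalRing R] {n : ℕ} {π : MvPolynomial (Fin n) k →ₐ[k] R}
    {α : Fin 3 → Fin n → ℕ} (h : IsMonomialQuotient π (stdMonomials α))
    {P : Set (PrimeSpectrum R)} (hP : AdmissiblePrimes P) (h3 : Condition3 P)
    (u v : Fin n → ℕ) (l : Fin n) (huv : ∀ i, u ≤ α i → ∃ q, α i + v ≤ α q + u)
    (hu : ∃ i, u + Pi.single l 1 ≤ α i) : v ≤ u + Pi.single l 1 := by
  have hs : ∀ s, (Finsupp.single l 1 : Fin n →₀ ℕ) s = (Pi.single l 1 : Fin n → ℕ) s := fun s => by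
    rw [Finsupp.single_eq_pi_single]
  have := h.le_of_condition3 hP h3 (u := Finsupp.equivFunOnFinite.symm u)
    (v := Finsupp.equivFunOnFinite.symm v) (l := l) ?_ ?_
  · intro s
    have h1 := this s
    rw [Finsupp.add_apply, hs] at h1
    exact h1
  · rintro w ⟨i, hi⟩
    have hi' : ∀ s, w s + u s ≤ α i s := hi
    obtain ⟨q, hq⟩ := huv i fun s => (Nat.le_add_left _ _).trans (hi' s)
    refine ⟨q, fun s => ?_⟩
    have h1 : α i s + v s ≤ α q s + u s := hq s
    have h2 := hi' s
    change w s + v s ≤ α q s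
    omega
  · obtain ⟨i, hi⟩ := hu
    refine ⟨i, fun s => ?_⟩
    rw [Finsupp.add_apply, hs]
    exact hi s

/-! ### Sorting variables by a numerical key -/

section Sorting

variable {n : ℕ}

theorem Monotone.exists_lt_iff_val_lt {g : Fin n → ℕ} (hg : Monotone g) (c : ℕ) :
    ∃ s ≤ n, ∀ x, g x < c ↔ (x : ℕ) < s := by
  by_cases hex : ∃ s, ∃ hs : s < n, c ≤ g ⟨s, hs⟩
  · classical
    obtain ⟨hs, hc⟩ := Nat.find_spec hex
    refine ⟨Nat.find hex, hs.le, fun x => ⟨fun hx => ?_, fun hx => ?_⟩⟩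
    · by_contra hle
      have h1 : g ⟨Nat.find hex, hs⟩ ≤ g x := hg (Fin.mk_le_of_le_val (not_lt.mp hle))
      omega
    · have := Nat.find_min hex hx
      push Not at this
      exact this x.2
  · push Not at hex
    exact ⟨n, le_rfl, fun x => ⟨fun _ => x.2, fun _ => hex x x.2⟩⟩

theorem sort_eq_iff_val_eq_zero {key : Fin n → ℕ} {l : Fin n} (hl : key l = 0)
    (hkey : ∀ s, s ≠ l → 1 ≤ key s) (x : Fin n) : Tuple.sort key x = l ↔ (x : ℕ) = 0 := by
  have hmain : ∀ y : Fin n, (y : ℕ) = 0 → Tuple.sort key y = l := by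
    intro y hy
    by_contra hne
    have h1 := hkey _ hne
    have h2 : key (Tuple.sort key y) ≤ key (Tuple.sort key ((Tuple.sort key).symm l)) :=
      Tuple.monotone_sort key (Fin.le_def.mpr (by omega))
    rw [Equiv.apply_symm_apply] at h2
    omega
  refine ⟨fun h => ?_, hmain x⟩
  have := hmain ⟨0, x.pos⟩ rfl
  rw [← h] at this
  rw [← (Tuple.sort key).injective this]

theorem sort_eq_iff_val_eq_one {key : Fin n → ℕ} {l t : Fin n} (hl : key l = 0) (ht : key t = 1)
    (hkey : ∀ s, s ≠ l → s ≠ t → 2 ≤ key s) (x : Fin n) :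
    Tuple.sort key x = t ↔ (x : ℕ) = 1 := by
  have hkey0 : ∀ s, s ≠ l → 1 ≤ key s := by
    intro s hs
    by_cases hst : s = t
    · rw [hst, ht]
    · exact one_le_two.trans (hkey s hs hst)
  have hlt : t ≠ l := by
    rintro rfl
    omega
  have hzero := sort_eq_iff_val_eq_zero hl hkey0
  have hpos : ((Tuple.sort key).symm t : ℕ) ≠ 0 := by
    intro h
    rw [← hzero, Equiv.apply_symm_apply] at h
    exact hlt h
  have hmain : ∀ y : Fin n, (y : ℕ) = 1 → Tuple.sort key y = t := by
    intro y hy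
    by_contra hne
    have h1 := hkey _ (fun h => by rw [hzero] at h; omega) hne
    have h2 : key (Tuple.sort key y) ≤ key (Tuple.sort key ((Tuple.sort key).symm t)) :=
      Tuple.monotone_sort key (Fin.le_def.mpr (by omega))
    rw [Equiv.apply_symm_apply] at h2
    omega
  refine ⟨fun h => ?_, hmain x⟩
  have hn : 1 < n := by
    have := ((Tuple.sort key).symm t).2
    omega
  have := hmain ⟨1, hn⟩ rfl
  rw [← h] at this
  rw [← (Tuple.sort key).injective this]

end Sorting

/-! ### Normal forms for the five shapes -/

section Classification

variable {k : Type u} [Field k] {n : ℕ}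

theorem nonempty_algEquiv_rows {m : ℕ} (a : Fin 3 → Fin n → ℕ+) {i j q : Fin 3}
    (hijq : Enumerates i j q) {φ : Fin m → Fin n} (hφ : Function.Injective φ)
    (ha : ∀ x, ∀ l ∉ Set.range φ, a x l = 1) {f g h : Fin m → ℕ+} (hf : ∀ x, f x = a i (φ x))
    (hg : ∀ x, g x = a j (φ x)) (hh : ∀ x, h x = a q (φ x)) :
    Nonempty ((MvPolynomial (Fin n) k ⧸ tripleIdeal k a) ≃ₐ[k]
      (MvPolynomial (Fin m) k ⧸ tripleIdeal k ![f, g, h])) := by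
  obtain rfl : f = fun x => a i (φ x) := funext hf
  obtain rfl : g = fun x => a j (φ x) := funext hg
  obtain rfl : h = fun x => a q (φ x) := funext hh
  refine nonempty_algEquiv (mem_tripleIdeal_iff a) (mem_tripleIdeal_iff _) hφ fun u => ?_
  rw [mem_stdMonomials_iff_exists_mapDomain hφ fun x l hl => by rw [ha x l hl]; rfl]
  have : stdMonomials (fun x l => (a x (φ l) : ℕ) - 1) = stdMonomials (fun x l =>
      ((![fun x => a i (φ x), fun x => a j (φ x), fun x => a q (φ x)] x l : ℕ+) : ℕ) - 1) := by
    ext v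
    constructor
    · rintro ⟨x, hx⟩
      rcases hijq.2.2.2 x with rfl | rfl | rfl
      exacts [⟨0, hx⟩, ⟨1, hx⟩, ⟨2, hx⟩]
    · rintro ⟨x, hx⟩
      fin_cases x
      exacts [⟨i, hx⟩, ⟨j, hx⟩, ⟨q, hx⟩]
  rw [this]

theorem eq_one_of_sub_one_eq_zero {a : ℕ+} (h : (a : ℕ) - 1 = 0) : a = 1 := by
  have := a.pos
  exact PNat.eq (by rw [PNat.one_coe]; omega)

theorem eq_add_one_of_sub_one_eq {a b : ℕ+} (h : (a : ℕ) - 1 = (b : ℕ) - 1 + 1) : a = b + 1 := by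
  have := a.pos
  have := b.pos
  exact PNat.eq (by rw [PNat.add_coe, PNat.one_coe]; omega)

theorem exists_listed_of_disjoint (a : Fin 3 → Fin n → ℕ+)
    (h : ∀ l x y, x ≠ y → (a x l : ℕ) - 1 = 0 ∨ (a y l : ℕ) - 1 = 0) :
    ∃ (m : ℕ) (I' : Ideal (MvPolynomial (Fin m) k)), IsListed I' ∧
      Nonempty ((MvPolynomial (Fin n) k ⧸ tripleIdeal k a) ≃ₐ[k]
        (MvPolynomial (Fin m) k ⧸ I')) := by
  -- The variables of row 2 come first, then those of row 1; the last block also takes variables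
  -- with exponent one in all rows.
  let key : Fin n → ℕ := fun l => if (a 2 l : ℕ) - 1 ≠ 0 then 0 else
    if (a 1 l : ℕ) - 1 ≠ 0 then 1 else 2
  obtain ⟨s, hs, hs'⟩ := Monotone.exists_lt_iff_val_lt (Tuple.monotone_sort key) 1
  obtain ⟨t, ht, ht'⟩ := Monotone.exists_lt_iff_val_lt (Tuple.monotone_sort key) 2
  let σ := Tuple.sort key
  have hst : s ≤ t := by
    by_contra hlt
    have h1 := (hs' ⟨t, by omega⟩).mpr (by simpa using hlt)
    have h2 := (ht' ⟨t, by omega⟩).mp (by omega)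
    exact lt_irrefl _ h2
  have hs0 : ∀ x : Fin n, (x : ℕ) < s ↔ (a 2 (σ x) : ℕ) - 1 ≠ 0 := fun x => by
    rw [← hs']
    simp only [Function.comp_apply, key, σ]
    split_ifs <;> simp_all
  have ht0 : ∀ x : Fin n, (x : ℕ) < t ↔ (a 2 (σ x) : ℕ) - 1 ≠ 0 ∨ (a 1 (σ x) : ℕ) - 1 ≠ 0 :=
    fun x => by
      rw [← ht']
      simp only [Function.comp_apply, key, σ]
      split_ifs <;> simp_all
  refine ⟨n, _, Or.inr (Or.inr (Or.inr (Or.inr ⟨s, t, fun x => a 2 (σ x), fun x => a 1 (σ x),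
    fun x => a 0 (σ x), hst, ht, rfl⟩))), ?_⟩
  refine nonempty_algEquiv_rows a (i := 0) (j := 1) (q := 2) (by unfold Enumerates; decide)
    (φ := σ) σ.injective (fun x l hl => absurd (σ.surjective l) hl) ?_ ?_ ?_
  · intro x
    split_ifs with hx
    · have h1 := h (σ x) 0 1 (by decide)
      have h2 := h (σ x) 0 2 (by decide)
      rw [ht0] at hx
      exact (eq_one_of_sub_one_eq_zero (by omega)).symm
    · rfl
  · intro x
    have h1 := h (σ x) 1 2 (by decide)
    have h2 := hs0 x
    have h3 := ht0 x
    split_ifs with hx hx'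
    · exact (eq_one_of_sub_one_eq_zero (by omega)).symm
    · rfl
    · exact (eq_one_of_sub_one_eq_zero (by omega)).symm
  · intro x
    have h2 := hs0 x
    split_ifs with hx
    · rfl
    · exact (eq_one_of_sub_one_eq_zero (by omega)).symm

theorem exists_listed_of_teter_shape (a : Fin 3 → Fin n → ℕ+) {i j q : Fin 3}
    (hijq : Enumerates i j q) {l s t : Fin n} (hl : (a j l : ℕ) - 1 = (a i l : ℕ) - 1 + 1)
    (hql : (a q l : ℕ) - 1 = (a i l : ℕ) - 1 + 1)
    (hsl : s ≠ l) (htl : t ≠ l) (hst : s ≠ t) (his : (a i s : ℕ) - 1 = (a j s : ℕ) - 1 + 1)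
    (hqs : (a q s : ℕ) - 1 = (a j s : ℕ) - 1 + 1) (hit : (a i t : ℕ) - 1 = (a q t : ℕ) - 1 + 1)
    (hjt : (a j t : ℕ) - 1 = (a q t : ℕ) - 1 + 1)
    (hr : ∀ r, r ≠ l → r ≠ s → r ≠ t → ∀ x, (a x r : ℕ) - 1 = 0) :
    ∃ (m : ℕ) (I' : Ideal (MvPolynomial (Fin m) k)), IsListed I' ∧
      Nonempty ((MvPolynomial (Fin n) k ⧸ tripleIdeal k a) ≃ₐ[k]
        (MvPolynomial (Fin m) k ⧸ I')) := by
  have hφ : Function.Injective ![l, s, t] := by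
    intro x y
    fin_cases x <;> fin_cases y <;> simp [hsl, htl, hst, hsl.symm, htl.symm, hst.symm]
  -- All other variables are zero in the quotient. In the remaining three, rows `i`, `j`, `q` are
  -- the corner of the box minus `e_l`, `e_s`, `e_t`.
  refine ⟨3, _, Or.inl ⟨![a j l, a i s, a i t], rfl⟩, ?_⟩
  refine nonempty_algEquiv (mem_tripleIdeal_iff a) (mem_teterIdeal_iff _) hφ fun u => ?_
  rw [mem_stdMonomials_iff_exists_mapDomain hφ fun x r hx => ?_]
  · have : stdMonomials (fun x y => (a x (![l, s, t] y) : ℕ) - 1) =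
        teterMonomials fun y => ((![a j l, a i s, a i t] y : ℕ+) : ℕ) := by
      ext v
      have hex : (∃ x, ∀ y, v y ≤ (a x (![l, s, t] y) : ℕ) - 1) ↔
          (∀ y, v y ≤ (a i (![l, s, t] y) : ℕ) - 1) ∨ (∀ y, v y ≤ (a j (![l, s, t] y) : ℕ) - 1) ∨
            ∀ y, v y ≤ (a q (![l, s, t] y) : ℕ) - 1 := by
        constructor
        · rintro ⟨x, hx⟩
          rcases hijq.2.2.2 x with rfl | rfl | rfl
          exacts [Or.inl hx, Or.inr (Or.inl hx), Or.inr (Or.inr hx)]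
        · rintro (h | h | h)
          exacts [⟨_, h⟩, ⟨_, h⟩, ⟨_, h⟩]
      simp only [stdMonomials, teterMonomials, Set.mem_ofPred_eq, hex]
      simp only [Fin.forall_fin_succ, Fin.exists_fin_succ, IsEmpty.forall_iff, IsEmpty.exists_iff,
        Matrix.cons_val_zero, Matrix.cons_val_succ, and_true, or_false]
      have e1 : (a j l : ℕ) = (a i l : ℕ) - 1 + 1 + 1 := by omega
      have e2 : (a i s : ℕ) = (a j s : ℕ) - 1 + 1 + 1 := by omega
      have e3 : (a i t : ℕ) = (a q t : ℕ) - 1 + 1 + 1 := by omega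
      rw [hl, hql, his, hqs, hit, hjt, e1, e2, e3]
      generalize (a i l : ℕ) - 1 = x, (a j s : ℕ) - 1 = y, (a q t : ℕ) - 1 = z
      generalize v 0 = v0, v (Fin.succ 0) = v1, v (Fin.succ (Fin.succ 0)) = v2
      clear * -
      constructor
      · rintro (h | h | h) <;> exact ⟨by omega, by omega⟩
      · rintro ⟨h, h' | h' | h'⟩
        · exact Or.inl (by omega)
        · exact Or.inr (Or.inl (by omega))
        · exact Or.inr (Or.inr (by omega))
    rw [this]
  · refine hr r ?_ ?_ ?_ x <;> rintro rfl
    exacts [hx ⟨0, rfl⟩, hx ⟨1, rfl⟩, hx ⟨2, rfl⟩]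

theorem exists_listed_of_square_shape (a : Fin 3 → Fin n → ℕ+) {i j q : Fin 3}
    (hijq : Enumerates i j q) {l t : Fin n} (hl : (a j l : ℕ) - 1 = (a i l : ℕ) - 1 + 1)
    (htl : t ≠ l) (hit : (a i t : ℕ) - 1 = (a j t : ℕ) - 1 + 1)
    (hql : (a q l : ℕ) - 1 = 0) (hqt : (a q t : ℕ) - 1 = 0)
    (hs : ∀ s, s ≠ l → s ≠ t → (a i s : ℕ) - 1 = 0 ∧ (a j s : ℕ) - 1 = 0) :
    ∃ (m : ℕ) (I' : Ideal (MvPolynomial (Fin m) k)), IsListed I' ∧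
      Nonempty ((MvPolynomial (Fin n) k ⧸ tripleIdeal k a) ≃ₐ[k]
        (MvPolynomial (Fin m) k ⧸ I')) := by
  classical
  let key : Fin n → ℕ := fun s => if s = l then 0 else if s = t then 1 else 2
  let σ := Tuple.sort key
  have h0 : ∀ x : Fin n, (x : ℕ) = 0 ↔ σ x = l := fun x =>
    (sort_eq_iff_val_eq_zero (by simp [key]) (fun s hs => by simp only [key]; grind) x).symm
  have h1 : ∀ x : Fin n, (x : ℕ) = 1 ↔ σ x = t := fun x =>
    (sort_eq_iff_val_eq_one (l := l) (by simp [key]) (by simp [key, htl])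
      (fun s hs => by simp only [key]; grind) x).symm
  have hn : 2 ≤ n := by
    have := (h1 (σ.symm t)).mpr (by simp)
    have := (σ.symm t).2
    omega
  refine ⟨n, _, Or.inr (Or.inr (Or.inl ⟨a i l, a j t, fun x => a q (σ x), hn, rfl⟩)), ?_⟩
  refine nonempty_algEquiv_rows a hijq (φ := σ) σ.injective
    (fun x l hl => absurd (σ.surjective l) hl) ?_ ?_ ?_
  · intro x
    split_ifs with hx hx'
    · rw [(h0 x).mp hx]
    · rw [(h1 x).mp hx', eq_add_one_of_sub_one_eq hit]
    · exact (eq_one_of_sub_one_eq_zero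
        (hs _ (fun h => hx ((h0 x).mpr h)) (fun h => hx' ((h1 x).mpr h))).1).symm
  · intro x
    split_ifs with hx hx'
    · rw [(h0 x).mp hx, eq_add_one_of_sub_one_eq hl]
    · rw [(h1 x).mp hx']
    · exact (eq_one_of_sub_one_eq_zero
        (hs _ (fun h => hx ((h0 x).mpr h)) (fun h => hx' ((h1 x).mpr h))).2).symm
  · intro x
    split_ifs with hx hx'
    · rw [(h0 x).mp hx, eq_one_of_sub_one_eq_zero hql]
    · rw [(h1 x).mp hx', eq_one_of_sub_one_eq_zero hqt]
    · rfl

theorem exists_listed_of_corner_shape (a : Fin 3 → Fin n → ℕ+) {i j q : Fin 3}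
    (hijq : Enumerates i j q) {l t : Fin n} (hl : (a j l : ℕ) - 1 = (a i l : ℕ) - 1 + 1)
    (htl : t ≠ l) (hqt : (a q t : ℕ) - 1 = (a i t : ℕ) - 1 + 1)
    (hj : ∀ s, s ≠ l → (a j s : ℕ) - 1 = 0) (hq : ∀ s, s ≠ t → (a q s : ℕ) - 1 = 0)
    (hs : ∃ s, s ≠ l ∧ s ≠ t ∧ 1 ≤ (a i s : ℕ) - 1) :
    ∃ (m : ℕ) (I' : Ideal (MvPolynomial (Fin m) k)), IsListed I' ∧
      Nonempty ((MvPolynomial (Fin n) k ⧸ tripleIdeal k a) ≃ₐ[k]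
        (MvPolynomial (Fin m) k ⧸ I')) := by
  classical
  -- Key 3 marks variables with exponent one in all rows. They are dropped, because the pattern
  -- requires `c > 1`.
  let key : Fin n → ℕ := fun s => if s = l then 0 else if s = t then 1 else
    if 1 ≤ (a i s : ℕ) - 1 then 2 else 3
  let σ := Tuple.sort key
  have h0 : ∀ x : Fin n, (x : ℕ) = 0 ↔ σ x = l := fun x =>
    (sort_eq_iff_val_eq_zero (by simp [key]) (fun s hs => by simp only [key]; grind) x).symm
  have h1 : ∀ x : Fin n, (x : ℕ) = 1 ↔ σ x = t := fun x =>
    (sort_eq_iff_val_eq_one (l := l) (by simp [key]) (by simp [key, htl])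
      (fun s hs => by simp only [key]; grind) x).symm
  obtain ⟨m, hm, hm'⟩ := Monotone.exists_lt_iff_val_lt (Tuple.monotone_sort key) 3
  have hm0 : ∀ x : Fin n, (x : ℕ) < m ↔ σ x = l ∨ σ x = t ∨ 1 ≤ (a i (σ x) : ℕ) - 1 := fun x => by
    rw [← hm']
    simp only [Function.comp_apply, key, σ]
    grind
  have hm3 : 3 ≤ m := by
    obtain ⟨s, hsl, hst, his⟩ := hs
    have e1 := (hm0 (σ.symm s)).mpr (Or.inr (Or.inr (by simpa using his)))
    have e2 : ((σ.symm s : Fin n) : ℕ) ≠ 0 := fun h => hsl (by simpa using (h0 _).mp h)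
    have e3 : ((σ.symm s : Fin n) : ℕ) ≠ 1 := fun h => hst (by simpa using (h1 _).mp h)
    omega
  let φ : Fin m → Fin n := fun x => σ (x.castLE hm)
  have hφ0 : ∀ x : Fin m, (x : ℕ) = 0 ↔ φ x = l := fun x => h0 (x.castLE hm)
  have hφ1 : ∀ x : Fin m, (x : ℕ) = 1 ↔ φ x = t := fun x => h1 (x.castLE hm)
  refine ⟨m, _, Or.inr (Or.inl ⟨a i l, a i t, fun x => a i (φ x), hm3, fun x hx => ?_, rfl⟩), ?_⟩
  · have h2 := (hm0 (x.castLE hm)).mp x.2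
    rw [← h0, ← h1] at h2
    simp only [Fin.val_castLE] at h2
    have h3 : 1 ≤ (a i (φ x) : ℕ) - 1 := by
      rcases h2 with h2 | h2 | h2
      · omega
      · omega
      · exact h2
    change 1 < a i (φ x)
    rw [← PNat.coe_lt_coe, PNat.one_coe]
    omega
  refine nonempty_algEquiv_rows a hijq (φ := φ)
    (σ.injective.comp (Fin.castLE_injective hm)) (fun x y hy => ?_) ?_ ?_ ?_
  · have hy' : ¬ ((σ.symm y : Fin n) : ℕ) < m := fun h =>
      hy ⟨⟨_, h⟩, by simp [φ]⟩
    rw [hm0, Equiv.apply_symm_apply] at hy'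
    push Not at hy'
    refine eq_one_of_sub_one_eq_zero ?_
    rcases hijq.2.2.2 x with rfl | rfl | rfl
    · omega
    · exact hj y hy'.1
    · exact hq y hy'.2.1
  · intro x
    split_ifs with hx hx'
    · rw [(hφ0 x).mp hx]
    · rw [(hφ1 x).mp hx']
    · rfl
  · intro x
    split_ifs with hx
    · rw [(hφ0 x).mp hx, eq_add_one_of_sub_one_eq hl]
    · exact (eq_one_of_sub_one_eq_zero (hj _ fun h => hx ((hφ0 x).mpr h))).symm
  · intro x
    split_ifs with hx
    · rw [(hφ1 x).mp hx, eq_add_one_of_sub_one_eq hqt]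
    · exact (eq_one_of_sub_one_eq_zero (hq _ fun h => hx ((hφ1 x).mpr h))).symm

theorem exists_listed_of_hook_shape (a : Fin 3 → Fin n → ℕ+) {i j q : Fin 3}
    (hijq : Enumerates i j q) {l : Fin n} (hl : (a j l : ℕ) - 1 = (a i l : ℕ) - 1 + 1)
    (hj : ∀ s, s ≠ l → (a j s : ℕ) - 1 = 0)
    (hql : (a q l : ℕ) - 1 = 0) (hs : ∀ s, s ≠ l → (a i s : ℕ) - 1 = 0 ∨ (a q s : ℕ) - 1 = 0) :
    ∃ (m : ℕ) (I' : Ideal (MvPolynomial (Fin m) k)), IsListed I' ∧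
      Nonempty ((MvPolynomial (Fin n) k ⧸ tripleIdeal k a) ≃ₐ[k]
        (MvPolynomial (Fin m) k ⧸ I')) := by
  classical
  -- Row `i` is trivial on the block with key 1, and row `q` on the block with key 2.
  let key : Fin n → ℕ := fun s => if s = l then 0 else if (a i s : ℕ) - 1 = 0 then 1 else 2
  let σ := Tuple.sort key
  have h0 : ∀ x : Fin n, (x : ℕ) = 0 ↔ σ x = l := fun x =>
    (sort_eq_iff_val_eq_zero (by simp [key]) (fun s hs => by simp only [key]; grind) x).symm
  obtain ⟨m, hm, hm'⟩ := Monotone.exists_lt_iff_val_lt (Tuple.monotone_sort key) 2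
  have hm0 : ∀ x : Fin n, (x : ℕ) < m ↔ σ x = l ∨ (a i (σ x) : ℕ) - 1 = 0 := fun x => by
    rw [← hm']
    simp only [Function.comp_apply, key, σ]
    grind
  have hm1 : 1 ≤ m := by
    have := (hm0 (σ.symm l)).mpr (Or.inl (by simp))
    omega
  refine ⟨n, _, Or.inr (Or.inr (Or.inr (Or.inl ⟨m, a i l, fun x => a i (σ x), fun x => a q (σ x),
    hm1, hm, rfl⟩))), ?_⟩
  refine nonempty_algEquiv_rows a hijq (φ := σ) σ.injective
    (fun x l hl => absurd (σ.surjective l) hl) ?_ ?_ ?_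
  · intro x
    split_ifs with hx hx'
    · rw [(h0 x).mp hx]
    · rw [hm0, ← h0] at hx'
      exact (eq_one_of_sub_one_eq_zero (by omega)).symm
    · rfl
  · intro x
    split_ifs with hx
    · rw [(h0 x).mp hx, eq_add_one_of_sub_one_eq hl]
    · exact (eq_one_of_sub_one_eq_zero (hj _ fun h => hx ((h0 x).mpr h))).symm
  · intro x
    split_ifs with hx hx'
    · rw [(h0 x).mp hx, eq_one_of_sub_one_eq_zero hql]
    · rfl
    · rw [hm0, ← h0] at hx'
      have := hs (σ x) fun h => hx ((h0 x).mpr h)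
      exact (eq_one_of_sub_one_eq_zero (by omega)).symm

end Classification

/-! ### The ideals of the classification satisfy the first condition -/

section Hubs

variable {n : ℕ} {α : Fin 3 → Fin n → ℕ}

/-- Every row which is positive in the coordinate `l` exceeds row `i` at most in the coordinate `l`,
and there by at most one, and no other two rows obstruct linearity of the map of degree
`α i + e_l`. -/
def IsTraceHub (α : Fin 3 → Fin n → ℕ) (l : Fin n) (i : Fin 3) : Prop :=
  (∀ j, 1 ≤ α j l → α j l ≤ α i l + 1 ∧ ∀ s, s ≠ l → α j s ≤ α i s) ∧
    ∀ j q t, α j l = α i l + 1 → α q l = 0 → α i t < α q t →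
      ∃ s, s ≠ l ∧ s ≠ t ∧ α j s + α q s < α i s

/-- Take `u = α i`. In a bad pair, `v` lies below a row `q` that exceeds row `i` at `t`; the first
clause forces `α q l = 0`, so `w` carries all of `α i l + 1` and lies below a bump `j`. At the `s`
of the second clause, `v + w` is then too small. -/
theorem IsTraceHub.exists_degree {l : Fin n} {i : Fin 3} (h : IsTraceHub α l i) :
    ∃ u ∈ stdMonomials α, ∀ (t : Fin n) (v w : Fin n →₀ ℕ),
      v + w = u + Finsupp.single l 1 + Finsupp.single t 1 → w t = 0 → v ∈ stdMonomials α →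
        w ∉ stdMonomials α := by
  refine ⟨Finsupp.equivFunOnFinite.symm (α i), ⟨i, fun _ => le_rfl⟩, ?_⟩
  rintro t v w hvw hwt ⟨q, hq⟩ ⟨j, hj⟩
  have hval : ∀ s, v s + w s = α i s + (Finsupp.single l 1 : Fin n →₀ ℕ) s +
      (Finsupp.single t 1 : Fin n →₀ ℕ) s := fun s => DFunLike.congr_fun hvw s
  have hoff : ∀ s, s ≠ l → s ≠ t → v s + w s = α i s := fun s h1 h2 => by
    have := hval s
    rwa [Finsupp.single_eq_of_ne h1, Finsupp.single_eq_of_ne h2] at this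
  have hqt := hq t
  have hvt := hval t
  rw [Finsupp.single_eq_same, hwt] at hvt
  have hql : α q l = 0 := by
    by_contra h0
    obtain ⟨h1, h2⟩ := h.1 q (Nat.one_le_iff_ne_zero.mpr h0)
    by_cases htl : t = l
    · subst htl
      rw [Finsupp.single_eq_same] at hvt
      omega
    · have := h2 t htl
      omega
  have hvl : v l = 0 := by
    have := hq l
    omega
  have htl : l ≠ t := by
    rintro rfl
    omega
  have hwl := hval l
  rw [Finsupp.single_eq_same, Finsupp.single_eq_of_ne htl, hvl] at hwl
  have hjl := hj l
  have hjl' := (h.1 j (by omega)).1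
  obtain ⟨s, hsl, hst, hs⟩ := h.2 j q t (by omega) hql (by omega)
  have h1 := hoff s hsl hst
  have h2 := hq s
  have h3 := hj s
  omega

theorem isTraceHub_of_unique {l : Fin n} {i : Fin 3} (hi : 1 ≤ α i l)
    (h : ∀ j, j ≠ i → α j l = 0) : IsTraceHub α l i := by
  refine ⟨fun j hj => ?_, fun j q t hj => ?_⟩
  · by_cases hji : j = i
    · subst hji
      exact ⟨by omega, fun _ _ => le_rfl⟩
    · have := h j hji
      omega
  · by_cases hji : j = i
    · subst hji
      omega
    · have := h j hji
      omega

theorem exists_isTraceHub_of_unique {l : Fin n} (hl : ∃ j, 1 ≤ α j l)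
    (h : ∀ i j, i ≠ j → α i l = 0 ∨ α j l = 0) : ∃ i, IsTraceHub α l i := by
  obtain ⟨i, hi⟩ := hl
  exact ⟨i, isTraceHub_of_unique hi fun j hj => (h j i hj).resolve_right (by omega)⟩

theorem fin_three_cases (x : Fin 3) : x = 0 ∨ x = 1 ∨ x = 2 := by
  decide +revert

theorem exists_isTraceHub_corner {p r : ℕ} (hn : 3 ≤ n)
    (h0 : ∀ s : Fin n, (s : ℕ) = 0 → α 0 s = p ∧ α 1 s = p + 1 ∧ α 2 s = 0)
    (h1 : ∀ s : Fin n, (s : ℕ) = 1 → α 0 s = r ∧ α 1 s = 0 ∧ α 2 s = r + 1)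
    (h2 : ∀ s : Fin n, 2 ≤ (s : ℕ) → 1 ≤ α 0 s ∧ α 1 s = 0 ∧ α 2 s = 0)
    (l : Fin n) : ∃ i, IsTraceHub α l i := by
  have hs : ∀ s : Fin n, (s : ℕ) = 0 ∨ (s : ℕ) = 1 ∨ 2 ≤ (s : ℕ) := fun s => by omega
  have hz := h2 ⟨2, hn⟩ le_rfl
  rcases hs l with hl | hl | hl
  · have hl' := h0 l hl
    have hne : ∀ s, s ≠ l → (s : ℕ) ≠ 0 := fun s hsl h => hsl (Fin.ext (h.trans hl.symm))
    -- The third variable separates: row 0 is positive there, rows 1 and 2 vanish. This is where `c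
    -- > 1` enters.
    refine ⟨0, fun j hj => ⟨?_, fun s hsl => ?_⟩, fun j q t hj hq ht => ⟨⟨2, hn⟩, ?_, ?_, ?_⟩⟩
    · rcases fin_three_cases j with rfl | rfl | rfl <;> omega
    · have := hne s hsl
      rcases hs s with h | h | h
      · omega
      · have := h1 s h
        rcases fin_three_cases j with rfl | rfl | rfl <;> omega
      · have := h2 s h
        rcases fin_three_cases j with rfl | rfl | rfl <;> omega
    · rintro rfl
      simp at hl
    · rintro rfl
      rcases fin_three_cases q with rfl | rfl | rfl <;> omega
    · rcases fin_three_cases j with rfl | rfl | rfl <;>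
        rcases fin_three_cases q with rfl | rfl | rfl <;> omega
  · have hl' := h1 l hl
    have hne : ∀ s, s ≠ l → (s : ℕ) ≠ 1 := fun s hsl h => hsl (Fin.ext (h.trans hl.symm))
    refine ⟨0, fun j hj => ⟨?_, fun s hsl => ?_⟩, fun j q t hj hq ht => ⟨⟨2, hn⟩, ?_, ?_, ?_⟩⟩
    · rcases fin_three_cases j with rfl | rfl | rfl <;> omega
    · have := hne s hsl
      rcases hs s with h | h | h
      · have := h0 s h
        rcases fin_three_cases j with rfl | rfl | rfl <;> omega
      · omega
      · have := h2 s h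
        rcases fin_three_cases j with rfl | rfl | rfl <;> omega
    · rintro rfl
      simp at hl
    · rintro rfl
      rcases fin_three_cases q with rfl | rfl | rfl <;> omega
    · rcases fin_three_cases j with rfl | rfl | rfl <;>
        rcases fin_three_cases q with rfl | rfl | rfl <;> omega
  · have hl' := h2 l hl
    refine ⟨0, isTraceHub_of_unique hl'.1 fun j hj => ?_⟩
    rcases fin_three_cases j with rfl | rfl | rfl
    exacts [absurd rfl hj, hl'.2.1, hl'.2.2]

theorem exists_isTraceHub_square {p r : ℕ} (hn : 2 ≤ n)
    (h0 : ∀ s : Fin n, (s : ℕ) = 0 → α 0 s = p ∧ α 1 s = p + 1 ∧ α 2 s = 0)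
    (h1 : ∀ s : Fin n, (s : ℕ) = 1 → α 0 s = r + 1 ∧ α 1 s = r ∧ α 2 s = 0)
    (h2 : ∀ s : Fin n, 2 ≤ (s : ℕ) → α 0 s = 0 ∧ α 1 s = 0)
    {l : Fin n} (hex : ∃ j, 1 ≤ α j l) : ∃ i, IsTraceHub α l i := by
  have hs : ∀ s : Fin n, (s : ℕ) = 0 ∨ (s : ℕ) = 1 ∨ 2 ≤ (s : ℕ) := fun s => by omega
  rcases hs l with hl | hl | hl
  · have hl' := h0 l hl
    have hne : ∀ s, s ≠ l → (s : ℕ) ≠ 0 := fun s hsl h => hsl (Fin.ext (h.trans hl.symm))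
    have hz := h1 ⟨1, hn⟩ rfl
    refine ⟨0, fun j hj => ⟨?_, fun s hsl => ?_⟩, fun j q t hj hq ht => ⟨⟨1, hn⟩, ?_, ?_, ?_⟩⟩
    · rcases fin_three_cases j with rfl | rfl | rfl <;> omega
    · have := hne s hsl
      rcases hs s with h | h | h
      · omega
      · have := h1 s h
        rcases fin_three_cases j with rfl | rfl | rfl <;> omega
      · have := h2 s h
        rcases fin_three_cases j with rfl | rfl | rfl <;> omega
    · rintro rfl
      simp at hl
    · rintro rfl
      rcases fin_three_cases q with rfl | rfl | rfl <;> omega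
    · rcases fin_three_cases j with rfl | rfl | rfl <;>
        rcases fin_three_cases q with rfl | rfl | rfl <;> omega
  · have hl' := h1 l hl
    have hne : ∀ s, s ≠ l → (s : ℕ) ≠ 1 := fun s hsl h => hsl (Fin.ext (h.trans hl.symm))
    have hz := h0 ⟨0, by omega⟩ rfl
    -- In the second variable the orientation is reversed, so the hub is row 1 and the separating
    -- variable is the first.
    refine ⟨1, fun j hj => ⟨?_, fun s hsl => ?_⟩,
      fun j q t hj hq ht => ⟨⟨0, by omega⟩, ?_, ?_, ?_⟩⟩
    · rcases fin_three_cases j with rfl | rfl | rfl <;> omega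
    · have := hne s hsl
      rcases hs s with h | h | h
      · have := h0 s h
        rcases fin_three_cases j with rfl | rfl | rfl <;> omega
      · omega
      · have := h2 s h
        rcases fin_three_cases j with rfl | rfl | rfl <;> omega
    · intro h
      have := congrArg Fin.val h
      simp only at this
      omega
    · intro h
      rw [h] at hz
      rcases fin_three_cases q with rfl | rfl | rfl <;> omega
    · rcases fin_three_cases j with rfl | rfl | rfl <;>
        rcases fin_three_cases q with rfl | rfl | rfl <;> omega
  · have hl' := h2 l hl
    refine exists_isTraceHub_of_unique hex fun x y hxy => ?_
    rcases fin_three_cases x with rfl | rfl | rfl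
    · exact Or.inl hl'.1
    · exact Or.inl hl'.2
    · rcases fin_three_cases y with rfl | rfl | rfl
      exacts [Or.inr hl'.1, Or.inr hl'.2, absurd rfl hxy]

theorem exists_isTraceHub_hook {p : ℕ}
    (h0 : ∀ s : Fin n, (s : ℕ) = 0 → α 0 s = p ∧ α 1 s = p + 1 ∧ α 2 s = 0)
    (h1 : ∀ s : Fin n, (s : ℕ) ≠ 0 → α 1 s = 0 ∧ (α 0 s = 0 ∨ α 2 s = 0))
    {l : Fin n} (hex : ∃ j, 1 ≤ α j l) : ∃ i, IsTraceHub α l i := by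
  by_cases hl : (l : ℕ) = 0
  · have hl' := h0 l hl
    have hne : ∀ s, s ≠ l → (s : ℕ) ≠ 0 := fun s hsl h => hsl (Fin.ext (h.trans hl.symm))
    by_cases hs : ∃ s, s ≠ l ∧ 1 ≤ α 0 s
    · obtain ⟨s, hsl, hs⟩ := hs
      have hs' := h1 s (hne s hsl)
      refine ⟨0, fun j hj => ⟨?_, fun t htl => ?_⟩, fun j q t hj hq ht => ⟨s, hsl, ?_, ?_⟩⟩
      · rcases fin_three_cases j with rfl | rfl | rfl <;> omega
      · have := h1 t (hne t htl)
        rcases fin_three_cases j with rfl | rfl | rfl <;> omega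
      · rintro rfl
        rcases fin_three_cases q with rfl | rfl | rfl <;> omega
      · rcases fin_three_cases j with rfl | rfl | rfl <;>
          rcases fin_three_cases q with rfl | rfl | rfl <;> omega
    -- Row 0 is now supported on `l` alone and lies below row 1. With row 1 as hub, the second
    -- clause is vacuous.
    · push Not at hs
      refine ⟨1, fun j hj => ⟨?_, fun t htl => ?_⟩, fun j q t hj => ?_⟩
      · rcases fin_three_cases j with rfl | rfl | rfl <;> omega
      · have := hs t htl
        rcases fin_three_cases j with rfl | rfl | rfl <;> omega
      · rcases fin_three_cases j with rfl | rfl | rfl <;> omega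
  · have hl' := h1 l hl
    refine exists_isTraceHub_of_unique hex fun x y hxy => ?_
    rcases fin_three_cases x with rfl | rfl | rfl <;>
      rcases fin_three_cases y with rfl | rfl | rfl <;> first | exact absurd rfl hxy | omega

end Hubs

/-! ### Trace ideals for the five families -/

section Listed

variable {k : Type u} [Field k] {n : ℕ} {R : Type u} [CommRing R] [IsLocalRing R] {ω : Type u}
  [AddCommGroup ω] [Module R ω]

theorem condition1_of_isTraceHub {a : Fin 3 → Fin n → ℕ+}
    (h : ∀ l, (∃ j, 1 ≤ (a j l : ℕ) - 1) → ∃ i, IsTraceHub (fun i l => (a i l : ℕ) - 1) l i)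
    (e : R ≃+* (MvPolynomial (Fin n) k ⧸ tripleIdeal k a)) (hω : IsCanonicalModule R ω) :
    Condition1 R ω := by
  refine condition1_of_ringEquiv (mem_tripleIdeal_iff a) (isLowerSet_stdMonomials _)
    (exists_notMem_stdMonomials _) (fun l hl => ?_) e hω
  obtain ⟨j, hj⟩ := hl
  have hjl := hj l
  rw [Finsupp.single_eq_same] at hjl
  obtain ⟨i, hi⟩ := h l ⟨j, hjl⟩
  exact hi.exists_degree

/-- Let `d` be the removed corner of the box. The map of degree `d` is linear because `v + w = d +
e_t` with `w t = 0` pushes `v` out of the box, and `d - e_l` is standard for each `l` in question.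
-/
theorem condition1_of_isTeterIdeal {I : Ideal (MvPolynomial (Fin n) k)} (hI : IsTeterIdeal I)
    (e : R ≃+* (MvPolynomial (Fin n) k ⧸ I)) (hω : IsCanonicalModule R ω) : Condition1 R ω := by
  obtain ⟨a, rfl⟩ := hI
  refine condition1_of_ringEquiv (mem_teterIdeal_iff a) ?_ ?_ ?_ e hω
  · rintro u v huv ⟨h1, l, hl⟩
    refine ⟨fun s => (huv s).trans_lt (h1 s), l, ?_⟩
    have h2 : v l ≤ u l := huv l
    have h3 : u l < a l := h1 l
    change v l + 1 ≠ a l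
    change u l + 1 ≠ a l at hl
    omega
  · intro l
    refine ⟨a l, fun h => ?_⟩
    have := h.1 l
    rw [Finsupp.single_eq_same] at this
    exact lt_irrefl _ this
  · rintro l ⟨h1, -⟩
    have hl : (Finsupp.single l 1 : Fin n →₀ ℕ) l < a l := h1 l
    rw [Finsupp.single_eq_same] at hl
    let d : Fin n →₀ ℕ := Finsupp.equivFunOnFinite.symm fun s => (a s : ℕ) - 1
    have hd : ∀ s, d s + 1 = a s := fun s => Nat.sub_add_cancel (a s).pos
    have hle : Finsupp.single l 1 ≤ d := by
      rw [Finsupp.single_le_iff]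
      have := hd l
      omega
    have hsub := tsub_add_cancel_of_le hle
    have hsub' : ∀ s, (d - Finsupp.single l 1 : Fin n →₀ ℕ) s +
        (Finsupp.single l 1 : Fin n →₀ ℕ) s = d s := DFunLike.congr_fun hsub
    refine ⟨d - Finsupp.single l 1, ⟨fun s => ?_, l, ?_⟩, ?_⟩
    · have h2 := hd s
      have h3 := hsub' s
      change (d - Finsupp.single l 1 : Fin n →₀ ℕ) s < a s
      omega
    · have h2 := hd l
      have h3 := hsub' l
      rw [Finsupp.single_eq_same] at h3
      change (d - Finsupp.single l 1 : Fin n →₀ ℕ) l + 1 ≠ a l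
      omega
    · intro t v w hvw hwt hv
      have h2 := DFunLike.congr_fun hvw t
      have h3 := hd t
      have h4 : v t < a t := hv.1 t
      rw [hsub, Finsupp.add_apply, Finsupp.add_apply, Finsupp.single_eq_same, hwt] at h2
      omega

theorem condition1_of_isListed {I : Ideal (MvPolynomial (Fin n) k)} (hI : IsListed I)
    (e : R ≃+* (MvPolynomial (Fin n) k ⧸ I)) (hω : IsCanonicalModule R ω) : Condition1 R ω := by
  rcases hI with h | ⟨a, b, c, hn, hc, rfl⟩ | ⟨a, b, c, hn, rfl⟩ | ⟨s, a, b, c, hs, hsn, rfl⟩ |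
    ⟨s, t, a, b, c, hst, htn, rfl⟩
  · exact condition1_of_isTeterIdeal h e hω
  · refine condition1_of_isTraceHub (fun l _ => exists_isTraceHub_corner (p := a - 1) (r := b - 1)
      hn (fun s hs => ?_) (fun s hs => ?_) (fun s hs => ?_) l) e hω
    · have := a.pos
      simp [hs]
      omega
    · have := b.pos
      simp [hs]
      omega
    · have h0 : (s : ℕ) ≠ 0 := by omega
      have h1 : (s : ℕ) ≠ 1 := by omega
      have h2 : (1 : ℕ) < c s := hc s hs
      simp [h0, h1]
      omega
  · refine condition1_of_isTraceHub (fun l hl => exists_isTraceHub_square (p := a - 1) (r := b - 1)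
      hn (fun s hs => ?_) (fun s hs => ?_) (fun s hs => ?_) hl) e hω
    · have := a.pos
      simp [hs]
      omega
    · have := b.pos
      simp [hs]
      omega
    · have h0 : (s : ℕ) ≠ 0 := by omega
      have h1 : (s : ℕ) ≠ 1 := by omega
      simp [h0, h1]
  · refine condition1_of_isTraceHub (fun l hl => exists_isTraceHub_hook (p := a - 1)
      (fun s hs => ?_) (fun s hs => ?_) hl) e hω
    · have := a.pos
      simp [hs]
      omega
    · simp only [Matrix.cons_val_zero, Matrix.cons_val_one, Matrix.cons_val, if_neg hs]
      split_ifs <;> simp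
  · refine condition1_of_isTraceHub (fun l hl => exists_isTraceHub_of_unique hl fun x y hxy => ?_)
      e hω
    rcases fin_three_cases x with rfl | rfl | rfl <;>
      rcases fin_three_cases y with rfl | rfl | rfl <;>
      simp only [Matrix.cons_val_zero, Matrix.cons_val_one, Matrix.cons_val] <;>
      first
      | exact absurd rfl hxy
      | split_ifs <;> first | simp | omega

end Listed

end AlmostGorenstein

theorem theorem5p4 {k : Type u} [Field k] {n : ℕ} (a : Fin 3 → Fin n → ℕ+)
    (htype : AlmostGorenstein.cmType
      (MvPolynomial (Fin n) k ⧸ AlmostGorenstein.tripleIdeal k a) = 3) :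
    (∃ (ω : Type u) (_ : AddCommGroup ω)
        (_ : Module (MvPolynomial (Fin n) k ⧸ AlmostGorenstein.tripleIdeal k a) ω),
        AlmostGorenstein.IsCanonicalModule
          (MvPolynomial (Fin n) k ⧸ AlmostGorenstein.tripleIdeal k a) ω) ∧
    ∀ (ω : Type u) [AddCommGroup ω]
      [Module (MvPolynomial (Fin n) k ⧸ AlmostGorenstein.tripleIdeal k a) ω],
      AlmostGorenstein.IsCanonicalModule
        (MvPolynomial (Fin n) k ⧸ AlmostGorenstein.tripleIdeal k a) ω →
      ∀ P : Set (PrimeSpectrum (MvPolynomial (Fin n) k ⧸ AlmostGorenstein.tripleIdeal k a)),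
        AlmostGorenstein.AdmissiblePrimes P →
        List.TFAE [
          AlmostGorenstein.Condition1
            (MvPolynomial (Fin n) k ⧸ AlmostGorenstein.tripleIdeal k a) ω,
          AlmostGorenstein.Condition2
            (MvPolynomial (Fin n) k ⧸ AlmostGorenstein.tripleIdeal k a),
          AlmostGorenstein.Condition3 P,
          ∃ (m : ℕ) (I' : Ideal (MvPolynomial (Fin m) k)), AlmostGorenstein.IsListed I' ∧
            Nonempty ((MvPolynomial (Fin n) k ⧸ AlmostGorenstein.tripleIdeal k a) ≃ₐ[k]
              (MvPolynomial (Fin m) k ⧸ I')),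
          ∃ (m : ℕ) (I' : Ideal (MvPolynomial (Fin m) k)), AlmostGorenstein.IsListed I' ∧
            Nonempty ((MvPolynomial (Fin n) k ⧸ AlmostGorenstein.tripleIdeal k a) ≃+*
              (MvPolynomial (Fin m) k ⧸ I'))] := by
  have hπ := AlmostGorenstein.isMonomialQuotient_mk (k := k) a
  refine ⟨⟨_, _, _, hπ.isCanonicalModule⟩, ?_⟩
  intro ω _ _ hω P hP
  tfae_have 1 → 2 := by
    have := hπ.isNoetherianRing
    exact fun h => h.condition2 hπ.isNilpotent_maximalIdeal hω.injective
  tfae_have 2 → 3 := fun h => h.condition3 P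
  tfae_have 3 → 4 := by
    intro h3
    have hanti : ∀ i j, i ≠ j → ¬ (fun l => (a i l : ℕ) - 1) ≤ fun l => (a j l : ℕ) - 1 :=
      fun i j hij => hπ.antichain_of_cmType htype hij
    have hM := hπ.le_of_condition3_stdMonomials hP h3
    rcases AlmostGorenstein.exists_shape hanti (AlmostGorenstein.hasHubs_of_forall hanti hM) (AlmostGorenstein.exists_pos_of_forall hM) with
      h | ⟨i, j, q, hijq, l, hl, h⟩
    · exact AlmostGorenstein.exists_listed_of_disjoint a h
    · rcases h with ⟨hql, s, t, hsl, htl, hst, ⟨h1, h2⟩, ⟨h3, h4⟩, hr⟩ |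
        ⟨t, htl, hit, hql, hqt, hs⟩ | ⟨t, htl, hqt, hj, hq, hs⟩ | ⟨hj, hql, hs⟩
      · exact AlmostGorenstein.exists_listed_of_teter_shape a hijq hl hql hsl htl hst h1 h2 h3 h4 hr
      · exact AlmostGorenstein.exists_listed_of_square_shape a hijq hl htl hit hql hqt hs
      · exact AlmostGorenstein.exists_listed_of_corner_shape a hijq hl htl hqt hj hq hs
      · exact AlmostGorenstein.exists_listed_of_hook_shape a hijq hl hj hql hs
  tfae_have 4 → 5 := fun ⟨m, I', hI', ⟨e⟩⟩ => ⟨m, I', hI', ⟨e.toRingEquiv⟩⟩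
  tfae_have 5 → 1 := fun ⟨m, I', hI', ⟨e⟩⟩ => AlmostGorenstein.condition1_of_isListed hI' e hω
  tfae_finish
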